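/- \textbf{Theorem (average degree with colluding eavesdroppers).} Let $\Pi_\ell,\Pi_e\subset\mathbb R^2$ be mutually independent homogeneous Poisson point processes with densities $\lambda_\ell>0$ (legitimate nodes) and $\lambda_e>0$ (eavesdroppers). Let $g(r)=r^{-2b}$ with $b>1$ be the channel gain at distance $r$, let $P_\ell>0$ be the common transmit power, and let $\sigma_\ell^2=\sigma_e^2>0$ be the (equal) noise powers. For $x\neq y$ in the set of legitimate nodes put \[ R_s(x,y)=\Bigl[\log_2\Bigl(1+\frac{P_\ell\, g(|x-y|)}{\sigma_\ell^2}\Bigr)-\log_2\Bigl(1+\frac{P_{\mathrm{rx},e}(x)}{\sigma_e^2}\Bigr)\Bigr]^+ , \] the maximum secrecy rate of the link from $x$ to $y$, where $P_{\mathrm{rx},e}(x)=\sum_{e\in\Pi_e}P_\ell\, g(|x-e|)$ if the eavesdroppers collude and $P_{\mathrm{rx},e}(x)=\max_{e\in\Pi_e}P_\ell\, g(|x-e|)$ if they do not. The Poisson $i\mathcal S$-graph with secrecy rate threshold $\varrho=0$ is the directed graph with vertex set $\Pi_\ell$ in which there is an edge from $x$ to $y\ne x$ if and only if $R_s(x,y)>0$.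 Let $N_{\mathrm{in}}$ and $N_{\mathrm{out}}$ be the in-degree and the out-degree of a typical node, that is, of a node at the origin in the graph built on $\Pi_\ell\cup\{0\}$; equivalently, their means are the Palm averages: for every Borel set $B$ of finite area, the expected sum of the degrees of the nodes in $\Pi_\ell\cap B$ is $\lambda_\ell|B|$ times the mean. Then, with colluding eavesdroppers, \[ \mathbb E\{N_{\mathrm{in}}\}=\mathbb E\{N_{\mathrm{out}}\}=\frac{\lambda_\ell}{\lambda_e}\,\mathrm{sinc}\Bigl(\frac1b\Bigr),\qquad \mathrm{sinc}(x)=\frac{\sin(\pi x)}{\pi x}, \] for both descriptions of the mean over a typical node. With non-colluding eavesdroppers the corresponding means are both $\lambda_\ell/\lambda_e$. Thus collusion degrades the mean connectivity by the factor $\mathrm{sinc}(1/b)$, and $0<\mathrm{sinc}(1/b)<1$. -/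

import Mathlib

open MeasureTheory ProbabilityTheory
open scoped ENNReal NNReal

noncomputable section

/-- The Euclidean plane. -/
abbrev Plane : Type := EuclideanSpace ℝ (Fin 2)

/-! ### Point processes in the plane -/

/-- The number of points (possibly infinite) that the random set `X` has in `A`. -/
def pointCount {Ω : Type*} (X : Ω → Set Plane) (A : Set Plane) (ω : Ω) : ℕ∞ :=
  (X ω ∩ A).encard

/-- `X` is a homogeneous Poisson point process on the plane with density `lam`: a random locally
finite set whose number of points in a Borel set of finite area is Poisson distributed with mean
`lam` times the area, the numbers of points in disjoint Borel sets being independent. -/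
structure IsPoissonProcess {Ω : Type*} [MeasurableSpace Ω] (X : Ω → Set Plane) (lam : ℝ≥0)
    (P : Measure Ω) : Prop where
  locallyFinite : ∀ ω, ∀ A : Set Plane, Bornology.IsBounded A → (X ω ∩ A).Finite
  measurable_count : ∀ A : Set Plane, MeasurableSet A → Measurable (pointCount X A)
  law_count : ∀ A : Set Plane, MeasurableSet A → volume A ≠ ∞ →
    P.map (pointCount X A) =
      (poissonMeasure (lam * (volume A).toNNReal)).map (Nat.cast : ℕ → ℕ∞)
  indep_count : ∀ (n : ℕ) (A : Fin n → Set Plane), (∀ i, MeasurableSet (A i)) →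
    Pairwise (Function.onFun Disjoint A) → iIndepFun (fun i => pointCount X (A i)) P

/-- The σ-algebra generated by a random set, i.e. by its numbers of points in all Borel sets. -/
abbrev pointSigma {Ω : Type*} (X : Ω → Set Plane) : MeasurableSpace Ω :=
  ⨆ (A : Set Plane) (_ : MeasurableSet A),
    MeasurableSpace.comap (pointCount X A) inferInstance

/-! ### Secrecy rates -/

/-- The binary logarithm on `[0, ∞]`, with values in `[-∞, ∞]`. -/
def binLog (x : ℝ≥0∞) : EReal := ENNReal.log x / ((Real.log 2 : ℝ) : EReal)

/-- The maximum secrecy rate `[log₂ (1 + s) - log₂ (1 + t)]⁺` of the Gaussian wiretap channel with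
signal-to-noise ratio `s` of the legitimate receiver and `t` of the (aggregate) eavesdropper. -/
def secrecyRate (s t : ℝ≥0∞) : EReal := max (binLog (1 + s) - binLog (1 + t)) 0

/-- The power gain `r ↦ 1 / r ^ (2 b)`, equal to `∞` at `r = 0`. -/
def powerLawGain (b : ℝ) (r : ℝ) : ℝ≥0∞ := 1 / ENNReal.ofReal r ^ (2 * b)

/-- The total power received from a transmitter at `x` by the colluding eavesdroppers `Ev`. -/
def colludingPower (g : ℝ → ℝ≥0∞) (Ptx : ℝ≥0) (Ev : Set Plane) (x : Plane) : ℝ≥0∞ :=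
  ∑' e : Ev, Ptx * g (dist x (e : Plane))

/-- The largest power received from a transmitter at `x` by a single eavesdropper in `Ev`. -/
def strongestPower (g : ℝ → ℝ≥0∞) (Ptx : ℝ≥0) (Ev : Set Plane) (x : Plane) : ℝ≥0∞ :=
  ⨆ e : Ev, Ptx * g (dist x (e : Plane))

/-! ### The graph -/

/-- The intrinsically secure communications graph on the legitimate nodes `L`, where
`evPower x` is the eavesdroppers' power for the transmitter `x`, `Ptx` the transmit power,
`noiseL` and `noiseE` the noise powers, and `rho` the secrecy rate threshold. -/
def secureGraph (g : ℝ → ℝ≥0∞) (Ptx noiseL noiseE : ℝ≥0) (rho : ℝ)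
    (evPower : Plane → ℝ≥0∞) (L : Set Plane) : Digraph L where
  Adj x y := x ≠ y ∧
    (rho : EReal) <
      secrecyRate (Ptx * g (dist (x : Plane) (y : Plane)) / noiseL) (evPower x / noiseE)

/-- The graph with legitimate nodes `L` and colluding eavesdroppers `Ev`. -/
def colludingGraph (g : ℝ → ℝ≥0∞) (Ptx noiseL noiseE : ℝ≥0) (rho : ℝ)
    (L Ev : Set Plane) : Digraph L :=
  secureGraph g Ptx noiseL noiseE rho (colludingPower g Ptx Ev) L

/-- The graph with legitimate nodes `L` and non-colluding eavesdroppers `Ev`. -/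
def nonColludingGraph (g : ℝ → ℝ≥0∞) (Ptx noiseL noiseE : ℝ≥0) (rho : ℝ)
    (L Ev : Set Plane) : Digraph L :=
  secureGraph g Ptx noiseL noiseE rho (strongestPower g Ptx Ev) L

/-- The number of edges leaving `v`. -/
def outDegree {V : Type*} (G : Digraph V) (v : V) : ℕ∞ := {w | G.Adj v w}.encard

/-- The number of edges entering `v`. -/
def inDegree {V : Type*} (G : Digraph V) (v : V) : ℕ∞ := {w | G.Adj w v}.encard

/-! ### Averages over a typical node -/

/-- `m` is the mean of the numerical mark `D L Ev x` of a typical point `x` of the process `X` of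
density `lam`, in the presence of the process `Y`. This is said in the two customary ways. In the
sense of Palm: the expected sum of the marks of the points of `X` in a Borel set `B` of finite area
is `m` times the expected number `lam * volume B` of these points. And for a node placed
at the origin: the mark of `0` in `X ∪ {0}` has expectation `m`. -/
structure IsTypicalMean {Ω : Type*} [MeasurableSpace Ω] (P : Measure Ω) (X Y : Ω → Set Plane)
    (lam : ℝ≥0) (D : ∀ L : Set Plane, Set Plane → L → ℕ∞) (m : ℝ≥0∞) : Prop where
  measurable_palm : ∀ B : Set Plane, MeasurableSet B → volume B ≠ ∞ →
    Measurable fun ω => ∑' x : {x : X ω // (x : Plane) ∈ B}, (D (X ω) (Y ω) x.1 : ℝ≥0∞)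
  palm : ∀ B : Set Plane, MeasurableSet B → volume B ≠ ∞ →
    ∫⁻ ω, ∑' x : {x : X ω // (x : Plane) ∈ B}, (D (X ω) (Y ω) x.1 : ℝ≥0∞) ∂P =
      lam * volume B * m
  measurable_origin : Measurable fun ω =>
    D (insert 0 (X ω)) (Y ω) ⟨0, Set.mem_insert 0 (X ω)⟩
  origin : ∫⁻ ω, (D (insert 0 (X ω)) (Y ω) ⟨0, Set.mem_insert 0 (X ω)⟩ : ℝ≥0∞) ∂P = m

/-- The average out-degree of a typical node of the random graph `G (X ω) (Y ω)` is `m`. -/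
def HasMeanOutDegree {Ω : Type*} [MeasurableSpace Ω] (P : Measure Ω) (X Y : Ω → Set Plane)
    (lam : ℝ≥0) (G : ∀ L : Set Plane, Set Plane → Digraph L) (m : ℝ≥0∞) : Prop :=
  IsTypicalMean P X Y lam (fun L Ev x => outDegree (G L Ev) x) m

/-- The average in-degree of a typical node of the random graph `G (X ω) (Y ω)` is `m`. -/
def HasMeanInDegree {Ω : Type*} [MeasurableSpace Ω] (P : Measure Ω) (X Y : Ω → Set Plane)
    (lam : ℝ≥0) (G : ∀ L : Set Plane, Set Plane → Digraph L) (m : ℝ≥0∞) : Prop :=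
  IsTypicalMean P X Y lam (fun L Ev x => inDegree (G L Ev) x) m

/-- The normalized cardinal sine `sin (π x) / (π x)`. -/
def normSinc (x : ℝ) : ℝ := Real.sin (Real.pi * x) / (Real.pi * x)

end

/-! With threshold 0 and equal noise powers, the logarithms and the noise cancel: x → y is an edge
exactly when the eavesdroppers' power V(x) is less than P g(|x - y|). The degree of x is therefore a
sum, over the other legitimate nodes y, of an indicator depending on x, y and the eavesdroppers. By
independence the eavesdroppers can be frozen while averaging over the legitimate nodes. Campbell's
formula settles the node at the origin, its second order version the Palm average; the diagonal term
vanishes as there are no loops (`isTypicalMean`).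

The law of V(x) does not depend on x, so in-degree and out-degree have the same mean, λ_ℓ ∫ P(V(0) <
P g(|y|)) dy (`hasMeanDegree`). By Tonelli the integral is the expected area of a disc, π E[(P /
V(0))^(1/b)].

For colluding eavesdroppers, the Laplace functional of the Poisson process (`lintegral_expNeg`)
gives E exp(-sV) = exp(-K s^(1/b)) with K = λ_e π Γ(1 - 1/b) P^(1/b), a stable law. Integrating
against s^(a-1) with a = 1/b gives E V^(-a) = 1 / (a K Γ(a)) (`lintegral_rpow_neg_of_laplace`). The
power P cancels, and Euler's reflection formula turns the Gamma factors into sinc(1/b) / λ_e.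

Without collusion, V(0) ≤ P g(|y|) says that no eavesdropper is closer to 0 than y. This has
probability exp(-λ_e π |y|²), whose integral over the plane is 1 / λ_e. -/

noncomputable section

/-! ### Kernels with finite values -/

/-- A kernel all of whose values are finite measures is s-finite, even if it is not uniformly
bounded. -/
theorem isSFiniteKernel_of_forall_isFiniteMeasure {α β : Type*} [MeasurableSpace α]
    [MeasurableSpace β] (κ : Kernel α β) (hκ : ∀ a, IsFiniteMeasure (κ a)) :
    IsSFiniteKernel κ := by
  classical
  have hmeas : Measurable fun a => ⌊(κ a Set.univ).toReal⌋₊ :=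
    Nat.measurable_floor.comp (κ.measurable_coe MeasurableSet.univ).ennreal_toReal
  have hset : ∀ k : ℕ, MeasurableSet {a | ⌊(κ a Set.univ).toReal⌋₊ = k} := fun k =>
    hmeas (measurableSet_singleton k)
  -- The kernel is cut according to the integer part of its total mass; the k-th piece has mass at
  -- most k + 1.
  let η : ℕ → Kernel α β := fun k => Kernel.piecewise (hset k) κ 0
  have hη : ∀ k, IsFiniteKernel (η k) := fun k => by
    refine ⟨⟨k + 1, by finiteness, fun a => ?_⟩⟩
    rw [Kernel.piecewise_apply]
    split_ifs with h
    · have h' : ⌊(κ a Set.univ).toReal⌋₊ = k := h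
      have h1 := (Nat.lt_floor_add_one (κ a Set.univ).toReal).le
      rw [h'] at h1
      rw [← ENNReal.ofReal_toReal (measure_ne_top (κ a) Set.univ)]
      refine (ENNReal.ofReal_le_ofReal h1).trans (le_of_eq ?_)
      rw [ENNReal.ofReal_add (by positivity) zero_le_one]
      simp
    · simp
  have hsum : κ = Kernel.sum η := by
    ext a s hs
    rw [Kernel.sum_apply' _ _ hs, tsum_eq_single ⌊(κ a Set.univ).toReal⌋₊]
    · simp [η, Kernel.piecewise_apply']
    · intro k hk
      simp [η, Kernel.piecewise_apply', hk.symm]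
  rw [hsum]
  exact Kernel.isSFiniteKernel_sum

/-! ### Configurations of points -/

/-- The space of locally finite subsets of the plane. -/
structure Config where
  /-- The underlying set. -/
  carrier : Set Plane
  locallyFinite : ∀ A : Set Plane, Bornology.IsBounded A → (carrier ∩ A).Finite

namespace Config

/-- Generated by the counts alone, so that its pullback along a random set is `pointSigma` (see
`comap_config`) and the independence hypothesis transfers to configurations. -/
instance : MeasurableSpace Config :=
  ⨆ (A : Set Plane) (_ : MeasurableSet A),
    MeasurableSpace.comap (fun S : Config => (S.1 ∩ A).encard) inferInstance

theorem measurable_encard {A : Set Plane} (hA : MeasurableSet A) :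
    Measurable fun S : Config => (S.1 ∩ A).encard := by
  intro t ht
  refine (le_iSup₂ (f := fun (A : Set Plane) (_ : MeasurableSet A) =>
    MeasurableSpace.comap (fun S : Config => (S.1 ∩ A).encard) inferInstance) A hA) _ ?_
  exact ⟨t, ht, rfl⟩

theorem countable (S : Config) : S.1.Countable := by
  have h : S.1 = ⋃ n : ℕ, S.1 ∩ Metric.ball 0 n := by
    rw [← Set.inter_iUnion, Metric.iUnion_ball_nat, Set.inter_univ]
  rw [h]
  exact Set.countable_iUnion fun n => (S.2 _ Metric.isBounded_ball).countable

theorem count_restrict_apply (S : Config) {A : Set Plane} (hA : MeasurableSet A) :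
    (Measure.count.restrict S.1) A = ((S.1 ∩ A).encard : ℝ≥0∞) := by
  rw [Measure.restrict_apply hA, Measure.count_apply (hA.inter S.countable.measurableSet),
    Set.inter_comm]

theorem _root_.measurable_toENNReal : Measurable ((↑) : ℕ∞ → ℝ≥0∞) := Measurable.of_discrete

/-- The kernel that sends a configuration to its counting measure. -/
def counting : Kernel Config Plane where
  toFun S := Measure.count.restrict S.1
  measurable' := by
    refine Measure.measurable_of_measurable_coe _ fun A hA => ?_
    simp_rw [count_restrict_apply _ hA]
    exact measurable_toENNReal.comp (measurable_encard hA)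

theorem counting_apply (S : Config) {A : Set Plane} (hA : MeasurableSet A) :
    counting S A = ((S.1 ∩ A).encard : ℝ≥0∞) := count_restrict_apply S hA

/-- Sums over points become kernel integrals, to which Tonelli applies. Countability of the carrier
makes measurability of `f` unnecessary. -/
theorem lintegral_counting (S : Config) (f : Plane → ℝ≥0∞) :
    ∫⁻ x, f x ∂(counting S) = ∑' x : S.1, f x := by
  change ∫⁻ x in S.1, f x ∂Measure.count = _
  rw [lintegral_countable _ S.countable]
  simp

theorem counting_lt_top (S : Config) {A : Set Plane} (hA : MeasurableSet A)
    (hb : Bornology.IsBounded A) : counting S A < ∞ := by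
  rw [counting_apply S hA]
  have := (S.2 A hb).encard_lt_top
  exact_mod_cast this

/-- On each annulus of a partition of the plane the counts are finite for every configuration,
though not uniformly bounded. S-finiteness is what makes parametrized integrals measurable and the
product kernel usable. -/
instance : IsSFiniteKernel counting := by
  let D : ℕ → Set Plane := disjointed fun n : ℕ => Metric.ball 0 n
  have hD : ∀ n, MeasurableSet (D n) :=
    fun n => MeasurableSet.disjointed (fun _ => measurableSet_ball) n
  have hsum : counting = Kernel.sum fun n => counting.restrict (hD n) := by
    ext S A hA
    rw [Kernel.sum_apply' _ _ hA]
    simp_rw [Kernel.restrict_apply' _ (hD _) _ hA]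
    rw [← measure_iUnion]
    · rw [← Set.inter_iUnion, iUnion_disjointed, Metric.iUnion_ball_nat, Set.inter_univ]
    · exact fun i j hij => ((disjoint_disjointed _ hij).mono Set.inter_subset_right
        Set.inter_subset_right)
    · exact fun n => hA.inter (hD n)
  rw [hsum]
  have (n : ℕ) : IsSFiniteKernel (counting.restrict (hD n)) := by
    refine isSFiniteKernel_of_forall_isFiniteMeasure _ fun S => ⟨?_⟩
    rw [Kernel.restrict_apply' _ _ _ MeasurableSet.univ, Set.univ_inter]
    exact counting_lt_top S (hD n) (Metric.isBounded_ball.subset (disjointed_subset _ n))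
  exact Kernel.isSFiniteKernel_sum

/-- Adding a point to a configuration. -/
def insertPoint (x : Plane) (S : Config) : Config :=
  ⟨insert x S.1, fun A hA => ((S.2 A hA).insert x).subset (by
    rintro y ⟨rfl | hy, hyA⟩
    · exact Set.mem_insert _ _
    · exact Set.mem_insert_of_mem _ ⟨hy, hyA⟩)⟩

end Config

/-! ### Poisson processes as random configurations -/

namespace IsPoissonProcess

variable {Ω : Type*} [MeasurableSpace Ω] {X : Ω → Set Plane} {lam : ℝ≥0} {P : Measure Ω}

/-- The configuration-valued random variable of a Poisson process. -/
def config (hX : IsPoissonProcess X lam P) (ω : Ω) : Config := ⟨X ω, hX.locallyFinite ω⟩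

theorem comap_config (hX : IsPoissonProcess X lam P) :
    MeasurableSpace.comap hX.config inferInstance = pointSigma X := by
  change MeasurableSpace.comap hX.config (⨆ (A : Set Plane) (_ : MeasurableSet A),
    MeasurableSpace.comap (fun S : Config => (S.1 ∩ A).encard) inferInstance) = _
  simp only [MeasurableSpace.comap_iSup, MeasurableSpace.comap_comp]
  rfl

theorem measurable_config (hX : IsPoissonProcess X lam P) : Measurable hX.config := by
  rw [measurable_iff_comap_le, hX.comap_config]
  exact iSup₂_le fun A hA => (hX.measurable_count A hA).comap_le

theorem counting_config (hX : IsPoissonProcess X lam P) (ω : Ω) {A : Set Plane}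
    (hA : MeasurableSet A) : Config.counting (hX.config ω) A = (pointCount X A ω : ℝ≥0∞) :=
  Config.counting_apply _ hA

end IsPoissonProcess

end

noncomputable section

/-! ### Moments of the Poisson distribution -/

theorem lintegral_poissonMeasure (r : ℝ≥0) (φ : ℕ → ℝ≥0∞) :
    ∫⁻ n, φ n ∂(poissonMeasure r) =
      ∑' n : ℕ, φ n * ENNReal.ofReal (Real.exp (-r) * r ^ n / n.factorial) := by
  rw [lintegral_countable']
  simp_rw [poissonMeasure_singleton]

/-- The shift n · rⁿ / n! = r · rⁿ⁻¹ / (n-1)! of the series; it yields the first two moments. -/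
theorem lintegral_id_mul_poissonMeasure (r : ℝ≥0) (φ : ℕ → ℝ≥0∞) :
    ∫⁻ n, n * φ n ∂(poissonMeasure r) = r * ∫⁻ n, φ (n + 1) ∂(poissonMeasure r) := by
  rw [lintegral_poissonMeasure, lintegral_poissonMeasure, tsum_eq_zero_add' ENNReal.summable,
    ← ENNReal.tsum_mul_left]
  simp only [Nat.cast_zero, zero_mul, zero_add]
  refine tsum_congr fun n => ?_
  have h : ((n + 1 : ℕ) : ℝ≥0∞) * ENNReal.ofReal (Real.exp (-r) * r ^ (n + 1) / (n + 1).factorial) =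
      r * ENNReal.ofReal (Real.exp (-r) * r ^ n / n.factorial) := by
    rw [← ENNReal.ofReal_natCast, ← ENNReal.ofReal_coe_nnreal, ← ENNReal.ofReal_mul (by positivity),
      ← ENNReal.ofReal_mul (by positivity)]
    congr 1
    rw [Nat.factorial_succ]
    push_cast
    field_simp
    ring
  rw [mul_right_comm, h, mul_assoc, mul_comm (φ (n + 1))]

theorem lintegral_id_poissonMeasure (r : ℝ≥0) : ∫⁻ n, (n : ℝ≥0∞) ∂(poissonMeasure r) = r := by
  simpa using lintegral_id_mul_poissonMeasure r fun _ => 1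

theorem lintegral_sq_poissonMeasure (r : ℝ≥0) :
    ∫⁻ n, (n : ℝ≥0∞) * n ∂(poissonMeasure r) = r * r + r := by
  rw [lintegral_id_mul_poissonMeasure]
  push_cast
  rw [lintegral_add_right _ measurable_const, lintegral_id_poissonMeasure]
  simp [mul_add]

theorem lintegral_pow_poissonMeasure (r z : ℝ≥0) :
    ∫⁻ n, (z : ℝ≥0∞) ^ n ∂(poissonMeasure r) = ENNReal.ofReal (Real.exp (-(r * (1 - z)))) := by
  have h1 : ∫⁻ _, 1 ∂(poissonMeasure (r * z)) = 1 := by simp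
  rw [lintegral_poissonMeasure] at h1 ⊢
  -- The series is a multiple of the total mass 1 of the Poisson law with parameter rz.
  rw [← mul_one (ENNReal.ofReal (Real.exp _)), ← h1, ← ENNReal.tsum_mul_left]
  refine tsum_congr fun n => ?_
  rw [one_mul, ← ENNReal.ofReal_mul (by positivity), ← ENNReal.ofReal_coe_nnreal,
    ← ENNReal.ofReal_pow (by positivity), ← ENNReal.ofReal_mul (by positivity)]
  congr 1
  have : Real.exp (-(r * (1 - z))) * Real.exp (-(r * z)) = Real.exp (-r) := by
    rw [← Real.exp_add]; congr 1; ring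
  rw [← this]
  push_cast
  ring

/-! ### Moment measures of a Poisson process -/

namespace IsPoissonProcess

variable {Ω : Type*} [MeasurableSpace Ω] {X : Ω → Set Plane} {lam : ℝ≥0} {P : Measure Ω}

theorem lintegral_pointCount (hX : IsPoissonProcess X lam P) {A : Set Plane}
    (hA : MeasurableSet A) (hfin : volume A ≠ ∞) (φ : ℕ∞ → ℝ≥0∞) :
    ∫⁻ ω, φ (pointCount X A ω) ∂P =
      ∫⁻ n : ℕ, φ n ∂(poissonMeasure (lam * (volume A).toNNReal)) := by
  rw [← lintegral_map (f := φ) Measurable.of_discrete (hX.measurable_count A hA),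
    hX.law_count A hA hfin, lintegral_map Measurable.of_discrete Measurable.of_discrete]

theorem lintegral_counting_apply (hX : IsPoissonProcess X lam P) {A : Set Plane}
    (hA : MeasurableSet A) (hfin : volume A ≠ ∞) :
    ∫⁻ ω, Config.counting (hX.config ω) A ∂P = lam * volume A := by
  simp_rw [hX.counting_config _ hA]
  rw [hX.lintegral_pointCount hA hfin (fun n => (n : ℝ≥0∞))]
  simp [lintegral_id_poissonMeasure, hfin]

theorem lintegral_counting_sq (hX : IsPoissonProcess X lam P) {A : Set Plane}
    (hA : MeasurableSet A) (hfin : volume A ≠ ∞) :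
    ∫⁻ ω, Config.counting (hX.config ω) A * Config.counting (hX.config ω) A ∂P =
      lam * volume A * (lam * volume A) + lam * volume A := by
  simp_rw [hX.counting_config _ hA]
  rw [hX.lintegral_pointCount hA hfin (fun n => (n : ℝ≥0∞) * n)]
  simp [lintegral_sq_poissonMeasure, hfin]

theorem measurable_counting_apply (hX : IsPoissonProcess X lam P) {A : Set Plane}
    (hA : MeasurableSet A) : Measurable fun ω => Config.counting (hX.config ω) A :=
  (Config.counting.measurable_coe hA).comp hX.measurable_config

theorem lintegral_counting_mul_of_disjoint (hX : IsPoissonProcess X lam P) {A B : Set Plane}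
    (hA : MeasurableSet A) (hB : MeasurableSet B) (hAB : Disjoint A B)
    (hAfin : volume A ≠ ∞) (hBfin : volume B ≠ ∞) :
    ∫⁻ ω, Config.counting (hX.config ω) A * Config.counting (hX.config ω) B ∂P =
      lam * volume A * (lam * volume B) := by
  have h := hX.indep_count 2 ![A, B] (by intro i; fin_cases i <;> assumption) (by
    intro i j hij
    fin_cases i <;> fin_cases j <;> simp_all [Function.onFun, disjoint_comm])
  have h2 : IndepFun (pointCount X A) (pointCount X B) P := by
    simpa using h.indepFun (show (0 : Fin 2) ≠ 1 by decide)
  have h3 := h2.comp (φ := fun n : ℕ∞ => (n : ℝ≥0∞)) (ψ := fun n : ℕ∞ => (n : ℝ≥0∞))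
    Measurable.of_discrete Measurable.of_discrete
  rw [← hX.lintegral_counting_apply hA hAfin, ← hX.lintegral_counting_apply hB hBfin]
  refine lintegral_mul_eq_lintegral_mul_lintegral_of_indepFun
    (hX.measurable_counting_apply hA) (hX.measurable_counting_apply hB) ?_
  convert h3 using 1
  · ext ω; exact hX.counting_config ω hA
  · ext ω; exact hX.counting_config ω hB

/-- Both sets are split along their intersection. Disjoint pieces are independent, and the only
excess over the product of means is the variance of the count in `A ∩ B`. -/
theorem lintegral_counting_mul (hX : IsPoissonProcess X lam P) {A B : Set Plane}
    (hA : MeasurableSet A) (hB : MeasurableSet B) (hAfin : volume A ≠ ∞) (hBfin : volume B ≠ ∞) :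
    ∫⁻ ω, Config.counting (hX.config ω) A * Config.counting (hX.config ω) B ∂P =
      lam * volume A * (lam * volume B) + lam * volume (A ∩ B) := by
  have hI := hA.inter hB
  have hA' := hA.diff hB
  have hB' := hB.diff hA
  have hIfin := measure_ne_top_of_subset (Set.inter_subset_left (s := A) (t := B)) hAfin
  have hA'fin := measure_ne_top_of_subset (Set.sdiff_subset (s := A) (t := B)) hAfin
  have hB'fin := measure_ne_top_of_subset (Set.sdiff_subset (s := B) (t := A)) hBfin
  have eA (μ : Measure Plane) : μ A = μ (A ∩ B) + μ (A \ B) := (measure_inter_add_sdiff A hB).symm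
  have eB (μ : Measure Plane) : μ B = μ (A ∩ B) + μ (B \ A) := by
    rw [Set.inter_comm]; exact (measure_inter_add_sdiff B hA).symm
  have m1 := hX.measurable_counting_apply hI
  have m2 := hX.measurable_counting_apply hA'
  have m3 := hX.measurable_counting_apply hB'
  have hd1 : Disjoint (A ∩ B) (B \ A) := Set.disjoint_left.2 fun x h1 h2 => h2.2 h1.1
  have hd2 : Disjoint (A \ B) (A ∩ B) := Set.disjoint_left.2 fun x h1 h2 => h1.2 h2.2
  have hd3 : Disjoint (A \ B) (B \ A) := Set.disjoint_left.2 fun x h1 h2 => h1.2 h2.1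
  simp_rw [fun ω => eA (Config.counting (hX.config ω)), fun ω => eB (Config.counting (hX.config ω)),
    add_mul, mul_add]
  rw [lintegral_add_left (by fun_prop), lintegral_add_left (by fun_prop),
    lintegral_add_left (by fun_prop), hX.lintegral_counting_sq hI hIfin,
    hX.lintegral_counting_mul_of_disjoint hI hB' hd1 hIfin hB'fin,
    hX.lintegral_counting_mul_of_disjoint hA' hI hd2 hA'fin hIfin,
    hX.lintegral_counting_mul_of_disjoint hA' hB' hd3 hA'fin hB'fin, eA volume, eB volume]
  ring

/-- Campbell's formula. -/
theorem lintegral_lintegral_counting (hX : IsPoissonProcess X lam P) {f : Plane → ℝ≥0∞}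
    (hf : Measurable f) :
    ∫⁻ ω, ∫⁻ x, f x ∂(Config.counting (hX.config ω)) ∂P = lam * ∫⁻ x, f x := by
  -- The intensity measure. Count laws are given for sets of finite area only, whence the comparison
  -- ball by ball.
  have key : (P.map hX.config).bind Config.counting = (lam : ℝ≥0∞) • (volume : Measure Plane) := by
    refine (Measure.ext_iff_of_iUnion_eq_univ (s := fun n : ℕ => Metric.ball (0 : Plane) n)
      (Metric.iUnion_ball_nat 0)).2 fun n => ?_
    ext A hA
    have hA' := hA.inter (measurableSet_ball (x := (0 : Plane)) (ε := n))
    rw [Measure.restrict_apply hA, Measure.restrict_apply hA,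
      Measure.bind_apply hA' Config.counting.aemeasurable,
      lintegral_map (Config.counting.measurable_coe hA') hX.measurable_config,
      hX.lintegral_counting_apply hA' (measure_ne_top_of_subset Set.inter_subset_right
        measure_ball_lt_top.ne)]
    rfl
  rw [← lintegral_map (hf.lintegral_kernel (κ := Config.counting)) hX.measurable_config,
    ← Measure.lintegral_bind Config.counting.aemeasurable hf.aemeasurable, key,
    lintegral_smul_measure]
  rfl

/-- The second order version of Campbell's formula. -/
theorem lintegral_lintegral_lintegral_counting [IsProbabilityMeasure P]
    (hX : IsPoissonProcess X lam P) {f : Plane × Plane → ℝ≥0∞} (hf : Measurable f) :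
    ∫⁻ ω, ∫⁻ x, ∫⁻ y, f (x, y) ∂(Config.counting (hX.config ω))
        ∂(Config.counting (hX.config ω)) ∂P =
      lam * (lam * ∫⁻ x, ∫⁻ y, f (x, y)) + lam * ∫⁻ x, f (x, x) := by
  let κ := Config.counting ×ₖ Config.counting
  have hdiag : Measurable fun x : Plane => (x, x) := by fun_prop
  -- The second moment measure: the diagonal part comes from points paired with themselves. Inside a
  -- bounded square the measures are finite and hence determined by rectangles.
  have key : (P.map hX.config).bind κ = (lam : ℝ≥0∞) • (lam : ℝ≥0∞) •
      ((volume : Measure Plane).prod volume) +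
        (lam : ℝ≥0∞) • (volume : Measure Plane).map fun x => (x, x) := by
    have hval : ∀ (n : ℕ) (A B : Set Plane), MeasurableSet A → MeasurableSet B →
        ((P.map hX.config).bind κ) ((A ∩ Metric.ball 0 n) ×ˢ (B ∩ Metric.ball 0 n)) =
          lam * volume (A ∩ Metric.ball 0 n) * (lam * volume (B ∩ Metric.ball 0 n)) +
            lam * volume ((A ∩ Metric.ball 0 n) ∩ (B ∩ Metric.ball 0 n)) := by
      intro n A B hA hB
      have hA' := hA.inter (measurableSet_ball (x := (0 : Plane)) (ε := n))
      have hB' := hB.inter (measurableSet_ball (x := (0 : Plane)) (ε := n))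
      rw [Measure.bind_apply (hA'.prod hB') κ.aemeasurable,
        lintegral_map (κ.measurable_coe (hA'.prod hB')) hX.measurable_config]
      simp only [κ, Kernel.prod_apply, Measure.prod_prod]
      exact hX.lintegral_counting_mul hA' hB'
        (measure_ne_top_of_subset Set.inter_subset_right measure_ball_lt_top.ne)
        (measure_ne_top_of_subset Set.inter_subset_right measure_ball_lt_top.ne)
    have hcover : ⋃ n : ℕ, Metric.ball (0 : Plane) n ×ˢ Metric.ball (0 : Plane) n = Set.univ := by
      refine Set.eq_univ_of_forall fun x => Set.mem_iUnion.2 ?_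
      obtain ⟨n, hn⟩ := exists_nat_gt (max (dist x.1 0) (dist x.2 0))
      exact ⟨n, (le_max_left _ _).trans_lt hn, (le_max_right _ _).trans_lt hn⟩
    refine (Measure.ext_iff_of_iUnion_eq_univ hcover).2 fun n => ?_
    have hfin : IsFiniteMeasure (((P.map hX.config).bind κ).restrict
        (Metric.ball (0 : Plane) n ×ˢ Metric.ball (0 : Plane) n)) := by
      have h := hval n Set.univ Set.univ MeasurableSet.univ MeasurableSet.univ
      have hb : volume (Metric.ball (0 : Plane) n) < ∞ := measure_ball_lt_top
      simp only [Set.univ_inter, Set.inter_self] at h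
      refine ⟨?_⟩
      rw [Measure.restrict_apply_univ, h]
      finiteness
    refine Measure.ext_prod fun {A B} hA hB => ?_
    rw [Measure.restrict_apply (hA.prod hB), Measure.restrict_apply (hA.prod hB),
      Set.prod_inter_prod, hval n A B hA hB]
    have hA' := hA.inter (measurableSet_ball (x := (0 : Plane)) (ε := n))
    have hB' := hB.inter (measurableSet_ball (x := (0 : Plane)) (ε := n))
    rw [Measure.add_apply, Measure.smul_apply, Measure.smul_apply, Measure.smul_apply,
      Measure.prod_prod, Measure.map_apply hdiag (hA'.prod hB')]
    simp only [smul_eq_mul]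
    congr 1
    ring
  have hκ : ∀ S, ∫⁻ x, ∫⁻ y, f (x, y) ∂(Config.counting S) ∂(Config.counting S) =
      ∫⁻ z, f z ∂(κ S) := fun S => by
    rw [Kernel.prod_apply, lintegral_prod _ hf.aemeasurable]
  simp_rw [hκ]
  rw [← lintegral_map (f := fun S => ∫⁻ z, f z ∂(κ S)) hf.lintegral_kernel hX.measurable_config,
    ← Measure.lintegral_bind κ.aemeasurable hf.aemeasurable, key, lintegral_add_measure,
    lintegral_smul_measure, lintegral_smul_measure, lintegral_smul_measure,
    lintegral_prod _ hf.aemeasurable, lintegral_map hf hdiag]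
  rfl

end IsPoissonProcess

end

noncomputable section

open Filter Topology

/-! ### The function `x ↦ exp (-x)` on `[0, ∞]` -/

/-- The function `x ↦ exp (-x)` on `[0, ∞]`. -/
def expNeg (x : ℝ≥0∞) : ℝ≥0∞ := EReal.exp (-(x : EReal))

theorem expNeg_coe (x : ℝ≥0) : expNeg x = ENNReal.ofReal (Real.exp (-x)) := by
  rw [← EReal.exp_coe]; rfl

theorem expNeg_ofReal {x : ℝ} (hx : 0 ≤ x) :
    expNeg (ENNReal.ofReal x) = ENNReal.ofReal (Real.exp (-x)) := by
  rw [ENNReal.ofReal, expNeg_coe, Real.coe_toNNReal x hx]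

@[simp] theorem expNeg_zero : expNeg 0 = 1 := by simp [expNeg]

@[simp] theorem expNeg_top : expNeg ∞ = 0 := by simp [expNeg]

theorem continuous_expNeg : Continuous expNeg :=
  ENNReal.continuous_exp.comp (continuous_neg.comp continuous_coe_ennreal_ereal)

@[fun_prop] theorem measurable_expNeg : Measurable expNeg := continuous_expNeg.measurable

theorem expNeg_le_one (x : ℝ≥0∞) : expNeg x ≤ 1 := by
  simp [expNeg, EReal.coe_ennreal_nonneg]

theorem expNeg_antitone : Antitone expNeg := fun x y h => by
  simpa [expNeg] using h

theorem expNeg_add (x y : ℝ≥0∞) : expNeg (x + y) = expNeg x * expNeg y := by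
  induction x using ENNReal.recTopCoe with
  | top => simp
  | coe x =>
    induction y using ENNReal.recTopCoe with
    | top => simp
    | coe y =>
      rw [← ENNReal.coe_add, expNeg_coe, expNeg_coe, expNeg_coe,
        ← ENNReal.ofReal_mul (Real.exp_pos _).le, ← Real.exp_add]
      congr 2
      push_cast
      ring

theorem expNeg_sum {ι : Type*} (s : Finset ι) (f : ι → ℝ≥0∞) :
    expNeg (∑ i ∈ s, f i) = ∏ i ∈ s, expNeg (f i) := by
  classical
  induction s using Finset.induction_on with
  | empty => simp
  | insert a s ha ih => rw [Finset.sum_insert ha, Finset.prod_insert ha, expNeg_add, ih]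

/-! ### Approximation by step functions -/

/-- The step function with the values `c i` on the sets `A i`. -/
def stepFun {k : ℕ} (c : Fin k → ℝ≥0) (A : Fin k → Set Plane) (x : Plane) : ℝ≥0∞ :=
  ∑ i, c i * (A i).indicator 1 x

theorem measurable_stepFun {k : ℕ} (c : Fin k → ℝ≥0) {A : Fin k → Set Plane}
    (hA : ∀ i, MeasurableSet (A i)) : Measurable (stepFun c A) :=
  Finset.measurable_fun_sum _ fun i _ =>
    measurable_const.mul (measurable_one.indicator (hA i))

theorem lintegral_stepFun {k : ℕ} (c : Fin k → ℝ≥0) {A : Fin k → Set Plane}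
    (hA : ∀ i, MeasurableSet (A i)) (μ : Measure Plane) :
    ∫⁻ x, stepFun c A x ∂μ = ∑ i, c i * μ (A i) := by
  simp only [stepFun]
  rw [lintegral_finsetSum _ fun i _ => (measurable_one.indicator (hA i)).const_mul _]
  refine Finset.sum_congr rfl fun i _ => ?_
  rw [lintegral_const_mul _ (measurable_one.indicator (hA i)), lintegral_indicator_one (hA i)]

/-- At most one term is nonzero at each point, and 1 - exp(-0) = 0, so the nonlinear function acts
on the coefficients. -/
theorem one_sub_expNeg_stepFun {k : ℕ} (c : Fin k → ℝ≥0) {A : Fin k → Set Plane}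
    (hd : Pairwise (Function.onFun Disjoint A)) (x : Plane) :
    1 - expNeg (stepFun c A x) = ∑ i, (1 - expNeg (c i)) * (A i).indicator 1 x := by
  by_cases h : ∃ i, x ∈ A i
  · obtain ⟨i, hi⟩ := h
    have hj : ∀ j, j ≠ i → x ∉ A j := fun j hji hxj => Set.disjoint_left.1 (hd hji) hxj hi
    rw [stepFun, Finset.sum_eq_single i, Finset.sum_eq_single i]
    · simp [hi]
    all_goals simp +contextual [hj]
  · push Not at h
    simp [stepFun, h]

/-- Finite values on disjoint sets of finite area are what the axioms on counts can handle;
truncation to growing balls ensures finite area. -/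
theorem exists_stepFun_approx {f : Plane → ℝ≥0∞} (hf : Measurable f) :
    ∃ (k : ℕ → ℕ) (c : ∀ n, Fin (k n) → ℝ≥0) (A : ∀ n, Fin (k n) → Set Plane),
      (∀ n i, MeasurableSet (A n i)) ∧ (∀ n, Pairwise (Function.onFun Disjoint (A n))) ∧
      (∀ n i, volume (A n i) ≠ ∞) ∧ (Monotone fun n => stepFun (c n) (A n)) ∧
      ∀ x, ⨆ n, stepFun (c n) (A n) x = f x := by
  let s : ℕ → SimpleFunc Plane ℝ≥0∞ := fun n =>
    (SimpleFunc.eapprox f n).restrict (Metric.ball 0 n)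
  have hs (n : ℕ) (x : Plane) :
      s n x = (Metric.ball (0 : Plane) n).indicator (SimpleFunc.eapprox f n) x := by
    rw [SimpleFunc.restrict_apply _ measurableSet_ball]
  -- The value 0 is left out because its level set has infinite area.
  let T : ℕ → Finset ℝ≥0∞ := fun n => (s n).range.filter (· ≠ 0)
  let e : ∀ n, Fin (T n).card ≃ T n := fun n => (T n).equivFin.symm
  have heq : ∀ n x, stepFun (fun i => ((e n i : ℝ≥0∞)).toNNReal)
      (fun i => (s n) ⁻¹' {(e n i : ℝ≥0∞)}) x = s n x := by
    intro n x
    have hlt : s n x ≠ ∞ := by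
      rw [hs]
      by_cases hx : x ∈ Metric.ball (0 : Plane) n
      · simpa [hx] using (SimpleFunc.eapprox_lt_top f n x).ne
      · simp [hx]
    by_cases h0 : s n x = 0
    · rw [h0, stepFun]
      refine Finset.sum_eq_zero fun i _ => ?_
      have h1 : (e n i : ℝ≥0∞) ≠ 0 := (Finset.mem_filter.1 (e n i).2).2
      have h2 : x ∉ (s n) ⁻¹' {(e n i : ℝ≥0∞)} := by
        simp only [Set.mem_preimage, Set.mem_singleton_iff, h0]
        exact h1.symm
      simp [h2]
    · have hmem : s n x ∈ T n := Finset.mem_filter.2 ⟨(s n).mem_range_self x, h0⟩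
      rw [stepFun, Finset.sum_eq_single ((e n).symm ⟨s n x, hmem⟩)]
      · simp [hlt]
      · intro j _ hj
        have h2 : x ∉ (s n) ⁻¹' {(e n j : ℝ≥0∞)} := by
          intro hx
          apply hj
          rw [Equiv.eq_symm_apply]
          exact Subtype.ext (Eq.symm hx)
        simp [h2]
      · simp
  have hmono : Monotone fun n => ⇑(s n) := by
    intro m n hmn x
    simp only [hs]
    by_cases hx : x ∈ Metric.ball (0 : Plane) m
    · have hx' : x ∈ Metric.ball (0 : Plane) n :=
        Metric.ball_subset_ball (by exact_mod_cast hmn) hx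
      simpa [hx, hx'] using SimpleFunc.monotone_eapprox f hmn x
    · simp [hx]
  refine ⟨fun n => (T n).card, fun n i => ((e n i : ℝ≥0∞)).toNNReal,
    fun n i => (s n) ⁻¹' {(e n i : ℝ≥0∞)}, fun n i => (s n).measurableSet_preimage _, ?_, ?_, ?_, ?_⟩
  · intro n i j hij
    refine Set.disjoint_left.2 fun x hx hx' => hij ?_
    exact (e n).injective (Subtype.ext (Eq.trans (Eq.symm hx) hx'))
  · intro n i
    have h1 : (e n i : ℝ≥0∞) ≠ 0 := (Finset.mem_filter.1 (e n i).2).2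
    refine measure_ne_top_of_subset (s := Metric.ball (0 : Plane) n) (fun x hx => ?_)
      (measure_ball_lt_top (μ := volume)).ne
    by_contra hxb
    apply h1
    rw [← (show s n x = e n i from hx), hs, Set.indicator_of_notMem hxb]
  · exact fun m n hmn x => by simpa only [heq] using hmono hmn x
  · intro x
    simp only [heq]
    refine tendsto_nhds_unique (tendsto_atTop_iSup ?_) ?_
    · exact fun m n hmn => hmono hmn x
    · refine (SimpleFunc.tendsto_eapprox hf x).congr' ?_
      obtain ⟨N, hN⟩ := exists_nat_gt (dist x 0)
      filter_upwards [eventually_ge_atTop N] with n hn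
      rw [hs, Set.indicator_of_mem]
      exact hN.trans_le (by exact_mod_cast hn)

theorem monotone_and_iSup_lintegral_stepFun {f : Plane → ℝ≥0∞} {k : ℕ → ℕ} {c : ∀ n, Fin (k n) → ℝ≥0}
    {A : ∀ n, Fin (k n) → Set Plane} (hA : ∀ n i, MeasurableSet (A n i))
    (hmono : Monotone fun n => stepFun (c n) (A n)) (hsup : ∀ x, ⨆ n, stepFun (c n) (A n) x = f x)
    (μ : Measure Plane) :
    (Monotone fun n => ∑ i, c n i * μ (A n i)) ∧
      ⨆ n, ∑ i, c n i * μ (A n i) = ∫⁻ x, f x ∂μ := by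
  simp_rw [← lintegral_stepFun _ (hA _), ← hsup]
  exact ⟨fun m n h => lintegral_mono (hmono h),
    (lintegral_iSup (fun n => measurable_stepFun _ (hA n)) hmono).symm⟩

/-! ### Laplace functional, void probabilities and invariance of a Poisson process -/

namespace IsPoissonProcess

variable {Ω : Type*} [MeasurableSpace Ω] {X : Ω → Set Plane} {lam : ℝ≥0} {P : Measure Ω}

theorem measurable_lintegral_counting (hX : IsPoissonProcess X lam P) {f : Plane → ℝ≥0∞}
    (hf : Measurable f) : Measurable fun ω => ∫⁻ x, f x ∂(Config.counting (hX.config ω)) :=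
  (hf.lintegral_kernel (κ := Config.counting)).comp hX.measurable_config

/-- The Poisson generating function at z = exp(-c). -/
theorem lintegral_expNeg_mul_counting (hX : IsPoissonProcess X lam P) {A : Set Plane}
    (hA : MeasurableSet A) (hfin : volume A ≠ ∞) (c : ℝ≥0) :
    ∫⁻ ω, expNeg (c * Config.counting (hX.config ω) A) ∂P =
      expNeg (lam * ((1 - expNeg c) * volume A)) := by
  simp_rw [hX.counting_config _ hA]
  rw [hX.lintegral_pointCount hA hfin (fun n => expNeg (c * n))]
  have h1 (n : ℕ) : expNeg (c * ((n : ℕ∞) : ℝ≥0∞)) = ((Real.exp (-c)).toNNReal : ℝ≥0∞) ^ n := by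
    rw [← ENNReal.ofReal, ← expNeg_coe, ENat.toENNReal_coe]
    induction n with
    | zero => simp
    | succ n ih => rw [pow_succ, ← ih, ← expNeg_add]; push_cast; rw [mul_add, mul_one]
  simp_rw [h1]
  rw [lintegral_pow_poissonMeasure, Real.coe_toNNReal _ (Real.exp_pos _).le]
  have hle : 0 ≤ 1 - Real.exp (-c) := by simp
  rw [← expNeg_ofReal (by positivity)]
  congr 1
  rw [expNeg_coe, ENNReal.ofReal_mul (by positivity), ENNReal.ofReal_sub _ (Real.exp_pos _).le,
    ENNReal.ofReal_one]
  push_cast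
  rw [ENNReal.ofReal_mul (by positivity), ENNReal.ofReal_coe_nnreal,
    ENNReal.ofReal_toReal hfin]
  ring

theorem lintegral_expNeg_stepFun (hX : IsPoissonProcess X lam P) {k : ℕ} (c : Fin k → ℝ≥0)
    {A : Fin k → Set Plane} (hA : ∀ i, MeasurableSet (A i))
    (hd : Pairwise (Function.onFun Disjoint A)) (hfin : ∀ i, volume (A i) ≠ ∞) :
    ∫⁻ ω, expNeg (∫⁻ x, stepFun c A x ∂(Config.counting (hX.config ω))) ∂P =
      expNeg (lam * ∫⁻ x, 1 - expNeg (stepFun c A x)) := by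
  simp_rw [lintegral_stepFun c hA, expNeg_sum, one_sub_expNeg_stepFun c hd]
  rw [lintegral_prod_eq_prod_lintegral_of_indepFun]
  · simp_rw [hX.lintegral_expNeg_mul_counting (hA _) (hfin _)]
    rw [lintegral_finsetSum _ fun i _ => (measurable_one.indicator (hA i)).const_mul _,
      Finset.mul_sum, expNeg_sum]
    refine Finset.prod_congr rfl fun i _ => ?_
    rw [lintegral_const_mul _ (measurable_one.indicator (hA i)), lintegral_indicator_one (hA i)]
  · have h := (hX.indep_count k A hA hd).comp (fun i (n : ℕ∞) => expNeg (c i * (n : ℝ≥0∞)))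
      fun i => Measurable.of_discrete
    convert h using 2 with i
    ext ω
    simp only [Function.comp_apply, hX.counting_config ω (hA i)]
  · exact fun i => measurable_expNeg.comp
      (measurable_const.mul (hX.measurable_counting_apply (hA i)))

/-- The Laplace functional of a Poisson process. -/
theorem lintegral_expNeg [IsProbabilityMeasure P] (hX : IsPoissonProcess X lam P)
    {f : Plane → ℝ≥0∞} (hf : Measurable f) :
    ∫⁻ ω, expNeg (∫⁻ x, f x ∂(Config.counting (hX.config ω))) ∂P =
      expNeg (lam * ∫⁻ x, 1 - expNeg (f x)) := by
  obtain ⟨k, c, A, hA, hd, hfin, hmono, hsup⟩ := exists_stepFun_approx hf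
  have hlim (μ : Measure Plane) : Tendsto (fun n => ∫⁻ x, stepFun (c n) (A n) x ∂μ) atTop
      (𝓝 (∫⁻ x, f x ∂μ)) := by
    simp_rw [← hsup]
    rw [lintegral_iSup (fun n => measurable_stepFun _ (hA n)) hmono]
    exact tendsto_atTop_iSup fun m n h => lintegral_mono (hmono h)
  have h1 : Tendsto
      (fun n => ∫⁻ ω, expNeg (∫⁻ x, stepFun (c n) (A n) x ∂(Config.counting (hX.config ω))) ∂P)
      atTop (𝓝 (∫⁻ ω, expNeg (∫⁻ x, f x ∂(Config.counting (hX.config ω))) ∂P)) := by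
    -- Here the integrands decrease, and the bound 1 on a probability space is used; on the other
    -- side 1 - exp(-f) increases, so monotone convergence applies without integrability.
    refine tendsto_lintegral_of_dominated_convergence (fun _ => 1) (fun n => ?_) (fun n => ?_)
      (by simp) (ae_of_all _ fun ω => ?_)
    · exact measurable_expNeg.comp (hX.measurable_lintegral_counting (measurable_stepFun _ (hA n)))
    · exact ae_of_all _ fun ω => expNeg_le_one _
    · exact (continuous_expNeg.tendsto _).comp (hlim _)
  have h2 : Tendsto (fun n => ∫⁻ x, 1 - expNeg (stepFun (c n) (A n) x)) atTop
      (𝓝 (∫⁻ x, 1 - expNeg (f x))) := by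
    refine lintegral_tendsto_of_tendsto_of_monotone (fun n => ?_) (ae_of_all _ fun x => ?_)
      (ae_of_all _ fun x => ?_)
    · exact (measurable_const.sub (measurable_expNeg.comp (measurable_stepFun _ (hA n)))).aemeasurable
    · exact fun m n h => tsub_le_tsub_left (expNeg_antitone (hmono h x)) _
    · refine ENNReal.Tendsto.sub tendsto_const_nhds ((continuous_expNeg.tendsto _).comp ?_)
        (Or.inl ENNReal.one_ne_top)
      rw [← hsup]
      exact tendsto_atTop_iSup fun m n h => hmono h x
  refine tendsto_nhds_unique h1 ?_
  simp_rw [hX.lintegral_expNeg_stepFun (c _) (hA _) (hd _) (hfin _)]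
  exact (continuous_expNeg.tendsto _).comp
    (ENNReal.Tendsto.const_mul h2 (Or.inr ENNReal.coe_ne_top))

/-- The void probabilities of a Poisson process. -/
theorem measure_counting_eq_zero [IsProbabilityMeasure P] (hX : IsPoissonProcess X lam P)
    {A : Set Plane} (hA : MeasurableSet A) :
    P {ω | Config.counting (hX.config ω) A = 0} = expNeg (lam * volume A) := by
  -- For the function ∞ · 1_A, the exponential of minus the integral is the indicator that A
  -- contains no point.
  have h := hX.lintegral_expNeg (f := fun x => ∞ * A.indicator 1 x)
    (measurable_const.mul (measurable_one.indicator hA))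
  have h1 : ∀ x, 1 - expNeg (∞ * A.indicator 1 x) = A.indicator 1 x := fun x => by
    by_cases hx : x ∈ A <;> simp [hx]
  simp_rw [h1, lintegral_indicator_one hA,
    lintegral_const_mul _ (measurable_one.indicator hA), lintegral_indicator_one hA] at h
  have hm : MeasurableSet {ω | Config.counting (hX.config ω) A = 0} :=
    hX.measurable_counting_apply hA (measurableSet_singleton 0)
  rw [← h, ← lintegral_indicator_one hm]
  refine lintegral_congr fun ω => ?_
  by_cases h0 : Config.counting (hX.config ω) A = 0
  · simp [h0]
  · rw [ENNReal.top_mul h0]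
    simp [h0]

/-- Independence makes the joint law a product of Poisson laws depending on the areas alone, and T
preserves areas. -/
theorem map_pointCount_preimage [IsProbabilityMeasure P] (hX : IsPoissonProcess X lam P)
    {T : Plane → Plane} (hT : MeasurePreserving T) {k : ℕ}
    {A : Fin k → Set Plane} (hA : ∀ i, MeasurableSet (A i))
    (hd : Pairwise (Function.onFun Disjoint A)) (hfin : ∀ i, volume (A i) ≠ ∞) :
    P.map (fun ω i => pointCount X (T ⁻¹' A i) ω) = P.map (fun ω i => pointCount X (A i) ω) := by
  have hA' : ∀ i, MeasurableSet (T ⁻¹' A i) := fun i => hT.measurable (hA i)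
  have hv : ∀ i, volume (T ⁻¹' A i) = volume (A i) := fun i =>
    hT.measure_preimage (hA i).nullMeasurableSet
  have h1 := hX.indep_count k A hA hd
  have h2 := hX.indep_count k (fun i => T ⁻¹' A i) hA' fun i j hij => (hd hij).preimage T
  rw [iIndepFun_iff_map_fun_eq_pi_map
    (fun i => (hX.measurable_count _ (hA i)).aemeasurable)] at h1
  rw [iIndepFun_iff_map_fun_eq_pi_map
    (fun i => (hX.measurable_count _ (hA' i)).aemeasurable)] at h2
  rw [h1, h2]
  congr 1
  ext1 i
  rw [hX.law_count _ (hA i) (hfin i), hX.law_count _ (hA' i) (by rw [hv]; exact hfin i), hv]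

/-- Integrals of a Poisson process keep their law when the integrand is composed with a measure
preserving map of the plane. -/
theorem map_lintegral_comp [IsProbabilityMeasure P] (hX : IsPoissonProcess X lam P)
    {T : Plane → Plane} (hT : MeasurePreserving T) {f : Plane → ℝ≥0∞} (hf : Measurable f) :
    P.map (fun ω => ∫⁻ x, f (T x) ∂(Config.counting (hX.config ω))) =
      P.map (fun ω => ∫⁻ x, f x ∂(Config.counting (hX.config ω))) := by
  have hm := hX.measurable_lintegral_counting hf
  have hm' : Measurable fun ω => ∫⁻ x, f (T x) ∂(Config.counting (hX.config ω)) :=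
    hX.measurable_lintegral_counting (hf.comp hT.measurable)
  have : IsProbabilityMeasure
      (P.map (fun ω => ∫⁻ x, f (T x) ∂(Config.counting (hX.config ω)))) :=
    Measure.isProbabilityMeasure_map hm'.aemeasurable
  refine Measure.ext_of_Iic _ _ fun t => ?_
  rw [Measure.map_apply hm measurableSet_Iic, Measure.map_apply hm' measurableSet_Iic]
  obtain ⟨k, c, A, hA, hd, hfin, hmono, hsup⟩ := exists_stepFun_approx hf
  have hA' : ∀ n i, MeasurableSet (T ⁻¹' A n i) := fun n i => hT.measurable (hA n i)
  have hstep : ∀ n x, stepFun (c n) (fun i => T ⁻¹' A n i) x = stepFun (c n) (A n) (T x) :=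
    fun n x => rfl
  -- The event that the integral is at most t is the decreasing limit of events about finitely many
  -- counts, whose joint laws are known to agree.
  have key (B : ∀ n, Fin (k n) → Set Plane) (hB : ∀ n i, MeasurableSet (B n i))
      (g : Plane → ℝ≥0∞) (hgmono : Monotone fun n => stepFun (c n) (B n))
      (hgsup : ∀ x, ⨆ n, stepFun (c n) (B n) x = g x) :
      Tendsto (fun n => P.map (fun ω i => pointCount X (B n i) ω)
          {v | ∑ i, (c n i : ℝ≥0∞) * (v i : ℝ≥0∞) ≤ t}) atTop
        (𝓝 (P ((fun ω => ∫⁻ x, g x ∂(Config.counting (hX.config ω))) ⁻¹' Set.Iic t))) := by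
    have hset (n : ℕ) : P.map (fun ω i => pointCount X (B n i) ω)
          {v | ∑ i, (c n i : ℝ≥0∞) * (v i : ℝ≥0∞) ≤ t} =
        P {ω | ∑ i, c n i * Config.counting (hX.config ω) (B n i) ≤ t} := by
      rw [Measure.map_apply]
      · congr 1
        ext ω
        simp [hX.counting_config ω (hB n _)]
      · exact measurable_pi_lambda _ fun i => hX.measurable_count _ (hB n i)
      · refine measurableSet_le (Finset.measurable_fun_sum _ fun i _ => ?_) measurable_const
        exact measurable_const.mul (measurable_toENNReal.comp (measurable_pi_apply i))
    simp_rw [hset]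
    have hinter : (fun ω => ∫⁻ x, g x ∂(Config.counting (hX.config ω))) ⁻¹' Set.Iic t =
        ⋂ n, {ω | ∑ i, c n i * Config.counting (hX.config ω) (B n i) ≤ t} := by
      ext ω
      rw [Set.mem_preimage,
        ← (monotone_and_iSup_lintegral_stepFun hB hgmono hgsup (Config.counting (hX.config ω))).2]
      simp
    rw [hinter]
    refine tendsto_measure_iInter_atTop (fun n => ?_) ?_ ⟨0, measure_ne_top _ _⟩
    · refine MeasurableSet.nullMeasurableSet
        (measurableSet_le (Finset.measurable_fun_sum _ fun i _ => ?_) measurable_const)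
      exact measurable_const.mul (hX.measurable_counting_apply (hB n i))
    · intro m n hmn ω hω
      exact ((monotone_and_iSup_lintegral_stepFun hB hgmono hgsup
        (Config.counting (hX.config ω))).1 hmn).trans hω
  refine tendsto_nhds_unique (key (fun n i => T ⁻¹' A n i) hA' (fun x => f (T x))
    (fun m n h x => hmono h (T x)) fun x => hsup (T x)) ?_
  simp_rw [hX.map_pointCount_preimage hT (hA _) (hd _) (hfin _)]
  exact key A hA f hmono hsup

end IsPoissonProcess

end

noncomputable section

/-! ### Averages of marks given by sums over pairs of points -/

theorem measurable_of_toENNReal {α : Type*} [MeasurableSpace α] {f : α → ℕ∞}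
    (hf : Measurable fun a => (f a : ℝ≥0∞)) : Measurable f := by
  refine measurable_to_countable' fun n => ?_
  have : f ⁻¹' {n} = (fun a => (f a : ℝ≥0∞)) ⁻¹' {(n : ℝ≥0∞)} := by
    ext a; simp
  rw [this]
  exact hf (measurableSet_singleton _)

namespace Config

/-- The added point contributes f x = 0, whether or not it was already present. -/
theorem lintegral_counting_insertPoint (S : Config) (x : Plane) {f : Plane → ℝ≥0∞}
    (hf : f x = 0) :
    ∫⁻ y, f y ∂(counting (insertPoint x S)) = ∫⁻ y, f y ∂(counting S) := by
  change ∫⁻ y in (insertPoint x S).1, f y ∂Measure.count = ∫⁻ y in S.1, f y ∂Measure.count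
  rw [← lintegral_indicator (insertPoint x S).countable.measurableSet,
    ← lintegral_indicator S.countable.measurableSet]
  refine lintegral_congr fun y => ?_
  have hmem : y ∈ (insertPoint x S).1 ↔ y = x ∨ y ∈ S.1 := Iff.rfl
  by_cases hyS : y ∈ S.1
  · rw [Set.indicator_of_mem (hmem.2 (Or.inr hyS)), Set.indicator_of_mem hyS]
  · rw [Set.indicator_of_notMem hyS]
    by_cases hy : y = x
    · rw [Set.indicator_of_mem (hmem.2 (Or.inl hy)), hy, hf]
    · rw [Set.indicator_of_notMem (by simp [hmem, hy, hyS])]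

theorem measurable_lintegral_counting {α : Type*} [MeasurableSpace α] {g : α → Config}
    (hg : Measurable g) {f : α × Plane → ℝ≥0∞} (hf : Measurable f) :
    Measurable fun a => ∫⁻ y, f (a, y) ∂(counting (g a)) :=
  Measurable.lintegral_kernel_prod_right' (κ := counting.comap g hg) hf

end Config

/-! ### Mean marks from independence and Campbell's formulas -/

namespace IsPoissonProcess

variable {Ω : Type*} [MeasurableSpace Ω] {X Y : Ω → Set Plane} {lamX lamY : ℝ≥0} {P : Measure Ω}

theorem indepFun_config (hX : IsPoissonProcess X lamX P) (hY : IsPoissonProcess Y lamY P)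
    (hXY : Indep (pointSigma X) (pointSigma Y) P) : IndepFun hX.config hY.config P := by
  rw [IndepFun_iff_Indep, hX.comap_config, hY.comap_config]
  exact hXY

/-- Independence gives the pair a product law; Tonelli then allows averaging over X with Y frozen.
-/
theorem lintegral_config_config [IsProbabilityMeasure P] (hX : IsPoissonProcess X lamX P)
    (hY : IsPoissonProcess Y lamY P) (hXY : Indep (pointSigma X) (pointSigma Y) P)
    {F : Config × Config → ℝ≥0∞} (hF : Measurable F) :
    ∫⁻ ω, F (hX.config ω, hY.config ω) ∂P =
      ∫⁻ ω', ∫⁻ ω, F (hX.config ω, hY.config ω') ∂P ∂P := by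
  have h := (indepFun_iff_map_prod_eq_prod_map_map hX.measurable_config.aemeasurable
    hY.measurable_config.aemeasurable).1 (hX.indepFun_config hY hXY)
  have hXm := hX.measurable_config
  have hYm := hY.measurable_config
  have : IsProbabilityMeasure (P.map hX.config) :=
    Measure.isProbabilityMeasure_map hXm.aemeasurable
  have : IsProbabilityMeasure (P.map hY.config) :=
    Measure.isProbabilityMeasure_map hYm.aemeasurable
  rw [← lintegral_map (f := F) hF (hXm.prodMk hYm), h, lintegral_prod_symm _ hF.aemeasurable,
    lintegral_map hF.lintegral_prod_left' hYm]
  refine lintegral_congr fun ω' => ?_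
  exact lintegral_map (f := fun S => F (S, hY.config ω')) (hF.comp measurable_prodMk_right) hXm

/-- Suppose that the mark of a point `x` is the sum of `H (x, y, Ev)` over the other points `y`,
where the expectation of `H (x, y, Y)`, integrated over `y`, is `c` for all `x`. Then the mean of
the mark of a typical point is `lamX * c`. -/
theorem isTypicalMean [IsProbabilityMeasure P] (hX : IsPoissonProcess X lamX P)
    (hY : IsPoissonProcess Y lamY P) (hXY : Indep (pointSigma X) (pointSigma Y) P)
    {D : ∀ L : Set Plane, Set Plane → L → ℕ∞} {H : Plane × Plane × Config → ℝ≥0∞}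
    (hH : Measurable H) (hdiag : ∀ x E, H (x, x, E) = 0)
    (hD : ∀ (S E : Config) (x : S.1),
      (D S.1 E.1 x : ℝ≥0∞) = ∫⁻ y, H (x, y, E) ∂(Config.counting S))
    {c : ℝ≥0∞} (hc : ∀ x, ∫⁻ y, ∫⁻ ω, H (x, y, hY.config ω) ∂P = c) :
    IsTypicalMean P X Y lamX D (lamX * c) := by
  have hXm := hX.measurable_config
  have hYm := hY.measurable_config
  have horigin (ω : Ω) : (D (insert 0 (X ω)) (Y ω) ⟨0, Set.mem_insert 0 (X ω)⟩ : ℝ≥0∞) =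
      ∫⁻ y, H (0, y, hY.config ω) ∂(Config.counting (hX.config ω)) := by
    have h := hD (Config.insertPoint 0 (hX.config ω)) (hY.config ω) ⟨0, Set.mem_insert 0 (X ω)⟩
    rw [Config.lintegral_counting_insertPoint _ _
      (f := fun y => H (0, y, hY.config ω)) (hdiag _ _)] at h
    exact h
  have hpalm (B : Set Plane) (hB : MeasurableSet B) (ω : Ω) :
      ∑' x : {x : X ω // (x : Plane) ∈ B}, (D (X ω) (Y ω) x.1 : ℝ≥0∞) =
        ∫⁻ x, ∫⁻ y, B.indicator 1 x * H (x, y, hY.config ω) ∂(Config.counting (hX.config ω))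
          ∂(Config.counting (hX.config ω)) := by
    rw [Config.lintegral_counting]
    refine (tsum_subtype {x : X ω | (x : Plane) ∈ B}
      (fun x => (D (X ω) (Y ω) x : ℝ≥0∞))).trans (tsum_congr fun x => ?_)
    have h : (D (X ω) (Y ω) x : ℝ≥0∞) = _ := hD (hX.config ω) (hY.config ω) x
    by_cases hx : (x : Plane) ∈ B
    · simp [hx, h]
    · simp [hx]
  have hF : Measurable fun p : Config × Config =>
      ∫⁻ y, H (0, y, p.2) ∂(Config.counting p.1) :=
    Config.measurable_lintegral_counting measurable_fst
      (f := fun q : (Config × Config) × Plane => H (0, q.2, q.1.2)) (by fun_prop)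
  have hG (B : Set Plane) (hB : MeasurableSet B) : Measurable fun p : Config × Config =>
      ∫⁻ x, ∫⁻ y, B.indicator 1 x * H (x, y, p.2) ∂(Config.counting p.1)
        ∂(Config.counting p.1) := by
    have hBm : Measurable (B.indicator (1 : Plane → ℝ≥0∞)) := measurable_one.indicator hB
    have h1 : Measurable fun q : (Config × Config) × Plane =>
        ∫⁻ y, B.indicator 1 q.2 * H (q.2, y, q.1.2) ∂(Config.counting q.1.1) :=
      Config.measurable_lintegral_counting (g := fun q : (Config × Config) × Plane => q.1.1)
        (by fun_prop) (f := fun r : ((Config × Config) × Plane) × Plane =>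
          B.indicator 1 r.1.2 * H (r.1.2, r.2, r.1.1.2)) (by fun_prop)
    exact Config.measurable_lintegral_counting measurable_fst h1
  constructor
  · intro B hB _
    simp_rw [hpalm B hB]
    exact (hG B hB).comp (hXm.prodMk hYm)
  · intro B hB _
    have hBm : Measurable (B.indicator (1 : Plane → ℝ≥0∞)) := measurable_one.indicator hB
    simp_rw [hpalm B hB]
    rw [hX.lintegral_config_config hY hXY (hG B hB)]
    -- The diagonal term of the second order formula disappears by `hdiag`.
    have h1 (ω' : Ω) : ∫⁻ ω, ∫⁻ x, ∫⁻ y, B.indicator 1 x * H (x, y, hY.config ω')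
        ∂(Config.counting (hX.config ω)) ∂(Config.counting (hX.config ω)) ∂P =
          lamX * (lamX * ∫⁻ x, ∫⁻ y, B.indicator 1 x * H (x, y, hY.config ω')) := by
      rw [hX.lintegral_lintegral_lintegral_counting
        (f := fun z => B.indicator 1 z.1 * H (z.1, z.2, hY.config ω')) (by fun_prop)]
      simp [hdiag]
    simp_rw [h1]
    have hm : Measurable fun z : (Ω × Plane) × Plane =>
      B.indicator (1 : Plane → ℝ≥0∞) z.1.2 * H (z.1.2, z.2, hY.config z.1.1) := by fun_prop
    rw [lintegral_const_mul _ (hm.lintegral_prod_right'.lintegral_prod_right'.const_mul _),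
      lintegral_const_mul _ hm.lintegral_prod_right'.lintegral_prod_right',
      lintegral_lintegral_swap hm.lintegral_prod_right'.aemeasurable]
    have h2 (x : Plane) : ∫⁻ ω, (∫⁻ y, B.indicator 1 x * H (x, y, hY.config ω)) ∂P =
        B.indicator 1 x * c := by
      rw [lintegral_lintegral_swap (by fun_prop), ← hc x, ← lintegral_const_mul]
      · refine lintegral_congr fun y => ?_
        rw [lintegral_const_mul _ (by fun_prop)]
      · exact Measurable.lintegral_prod_right'
          (f := fun z : Plane × Ω => H (x, z.1, hY.config z.2)) (by fun_prop)
    simp_rw [h2]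
    rw [lintegral_mul_const _ hBm, lintegral_indicator_one hB]
    ring
  · refine measurable_of_toENNReal ?_
    simp_rw [horigin]
    exact hF.comp (hXm.prodMk hYm)
  · simp_rw [horigin]
    rw [hX.lintegral_config_config hY hXY hF]
    have h1 (ω' : Ω) : ∫⁻ ω, ∫⁻ y, H (0, y, hY.config ω') ∂(Config.counting (hX.config ω)) ∂P =
        lamX * ∫⁻ y, H (0, y, hY.config ω') :=
      hX.lintegral_lintegral_counting (by fun_prop)
    simp only [h1]
    rw [lintegral_const_mul _ (Measurable.lintegral_prod_right'
      (f := fun z : Ω × Plane => H (0, z.2, hY.config z.1)) (by fun_prop)),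
      lintegral_lintegral_swap (by fun_prop), hc]

end IsPoissonProcess

end

noncomputable section

/-! ### Integrals -/

/-- A nonzero Bochner integral forces integrability, since the default value for non-integrable
functions is 0. -/
theorem lintegral_ofReal_eq_of_integral_eq {α : Type*} [MeasurableSpace α] {μ : Measure α}
    {f : α → ℝ} (hf : 0 ≤ᵐ[μ] f) {c : ℝ} (hc : 0 < c) (h : ∫ x, f x ∂μ = c) :
    ∫⁻ x, ENNReal.ofReal (f x) ∂μ = ENNReal.ofReal c := by
  rw [← h, ofReal_integral_eq_lintegral_ofReal (Integrable.of_integral_ne_zero (h ▸ hc.ne')) hf]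

/-- The rescaled Gamma integral. The conventions for powers fit at the ends: both sides are ∞ at w =
0, where the integral diverges, and 0 at w = ∞. -/
theorem lintegral_rpow_mul_expNeg {a : ℝ} (ha : 0 < a) (w : ℝ≥0∞) :
    ∫⁻ s in Set.Ioi (0 : ℝ), ENNReal.ofReal (s ^ (a - 1)) * expNeg (ENNReal.ofReal s * w) =
      ENNReal.ofReal (Real.Gamma a) * w ^ (-a) := by
  have hΓ := Real.Gamma_pos_of_pos ha
  induction w using ENNReal.recTopCoe with
  | top =>
    rw [ENNReal.top_rpow_of_neg (by linarith), mul_zero]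
    refine (setLIntegral_congr_fun measurableSet_Ioi fun s hs => ?_).trans (lintegral_zero)
    have : ENNReal.ofReal s ≠ 0 := by simpa using hs
    simp [ENNReal.mul_top this]
  | coe w =>
    rcases eq_or_ne w 0 with rfl | hw
    · rw [ENNReal.coe_zero, ENNReal.zero_rpow_of_neg (by linarith),
        ENNReal.mul_top (by simpa using hΓ)]
      by_contra hfin
      refine not_integrableOn_Ioi_rpow (a - 1) ⟨by fun_prop, ?_⟩
      rw [hasFiniteIntegral_iff_ofReal]
      · simpa [lt_top_iff_ne_top] using hfin
      · filter_upwards [ae_restrict_mem measurableSet_Ioi] with s hs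
        exact Real.rpow_nonneg (le_of_lt hs) _
    · have hw' : (0 : ℝ) < w := by positivity
      have h := lintegral_ofReal_eq_of_integral_eq (μ := volume.restrict (Set.Ioi 0)) ?_
        (by positivity) (Real.integral_rpow_mul_exp_neg_mul_Ioi ha hw')
      · rw [mul_comm, ENNReal.ofReal_mul (by positivity)] at h
        rw [← ENNReal.ofReal_coe_nnreal, ENNReal.ofReal_rpow_of_pos hw', Real.rpow_neg hw'.le,
          ← Real.inv_rpow hw'.le, ← one_div, ← h]
        refine setLIntegral_congr_fun measurableSet_Ioi fun s hs => ?_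
        have hs' : (0 : ℝ) < s := hs
        rw [← ENNReal.ofReal_mul hs'.le, expNeg_ofReal (by positivity),
          ← ENNReal.ofReal_mul (by positivity), mul_comm s]
      · filter_upwards [ae_restrict_mem measurableSet_Ioi] with s hs
        have hs' : (0 : ℝ) < s := hs
        simp only [Pi.zero_apply]
        positivity

theorem lintegral_rpow_mul_expNeg_rpow {p K : ℝ} (hp : 0 < p) (hK : 0 < K) :
    ∫⁻ s in Set.Ioi (0 : ℝ), ENNReal.ofReal (s ^ (p - 1)) * expNeg (ENNReal.ofReal (K * s ^ p)) =
      ENNReal.ofReal (1 / (p * K)) := by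
  have h := integral_rpow_mul_exp_neg_mul_rpow hp (q := p - 1) (by linarith) hK
  have h' : K ^ (-(p - 1 + 1) / p) * (1 / p) * Real.Gamma ((p - 1 + 1) / p) = 1 / (p * K) := by
    rw [sub_add_cancel, neg_div, div_self hp.ne', Real.rpow_neg_one, Real.Gamma_one]
    field_simp
  rw [h'] at h
  rw [← lintegral_ofReal_eq_of_integral_eq _ (by positivity) h]
  · refine setLIntegral_congr_fun measurableSet_Ioi fun s hs => ?_
    have hs' : (0 : ℝ) < s := hs
    rw [expNeg_ofReal (by positivity), ← ENNReal.ofReal_mul (by positivity), neg_mul]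
  · filter_upwards [ae_restrict_mem measurableSet_Ioi] with s hs
    have hs' : (0 : ℝ) < s := hs
    simp only [Pi.zero_apply]
    positivity

/-- Negative moments from the Laplace transform. -/
theorem lintegral_rpow_neg_of_laplace {α : Type*} [MeasurableSpace α] {μ : Measure α} [SFinite μ]
    {V : α → ℝ≥0∞} (hV : Measurable V) {a K : ℝ} (ha : 0 < a) (hK : 0 < K)
    (h : ∀ s : ℝ, 0 < s → ∫⁻ ω, expNeg (ENNReal.ofReal s * V ω) ∂μ =
      expNeg (ENNReal.ofReal (K * s ^ a))) :
    ∫⁻ ω, V ω ^ (-a) ∂μ = ENNReal.ofReal (1 / (a * K) / Real.Gamma a) := by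
  have hΓ := Real.Gamma_pos_of_pos ha
  have hm : Measurable fun z : α × ℝ =>
      ENNReal.ofReal (z.2 ^ (a - 1)) * expNeg (ENNReal.ofReal z.2 * V z.1) := by fun_prop
  have hneg : ENNReal.ofReal (Real.Gamma a) * ∫⁻ ω, V ω ^ (-a) ∂μ =
      ENNReal.ofReal (1 / (a * K)) := by
    rw [← lintegral_const_mul _ (hV.pow_const _), ← lintegral_rpow_mul_expNeg_rpow ha hK]
    -- Γ(a) V^(-a) is written as an integral over s, so that Tonelli brings in the Laplace transform
    -- of V.
    simp_rw [← lintegral_rpow_mul_expNeg ha]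
    rw [lintegral_lintegral_swap hm.aemeasurable]
    refine setLIntegral_congr_fun measurableSet_Ioi fun s hs => ?_
    rw [lintegral_const_mul' _ _ ENNReal.ofReal_ne_top, h s hs]
  rw [ENNReal.ofReal_div_of_pos hΓ, ← hneg, mul_comm, ENNReal.mul_div_cancel_right]
  · simpa using hΓ
  · exact ENNReal.ofReal_ne_top

/-- This is ∫ exp(-t) dt over 0 < t < u. The indicator keeps the domain independent of u, ready for
an exchange of integrals. -/
theorem one_sub_expNeg_eq_lintegral (u : ℝ≥0∞) :
    1 - expNeg u = ∫⁻ t in Set.Ioi (0 : ℝ),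
      {t : ℝ | ENNReal.ofReal t < u}.indicator 1 t * ENNReal.ofReal (Real.exp (-t)) := by
  have htail (r : ℝ) :
      ∫⁻ t in Set.Ioi r, ENNReal.ofReal (Real.exp (-t)) = ENNReal.ofReal (Real.exp (-r)) :=
    lintegral_ofReal_eq_of_integral_eq (ae_of_all _ fun t => (Real.exp_pos _).le) (Real.exp_pos _)
      (integral_exp_neg_Ioi r)
  induction u using ENNReal.recTopCoe with
  | top => simp [htail]
  | coe u =>
    have h1 : ∫⁻ t in Set.Ioi (0 : ℝ),
        {t : ℝ | ENNReal.ofReal t < u}.indicator 1 t * ENNReal.ofReal (Real.exp (-t)) =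
        ∫⁻ t in Set.Ioo (0 : ℝ) u, ENNReal.ofReal (Real.exp (-t)) := by
      rw [← lintegral_indicator measurableSet_Ioi, ← lintegral_indicator measurableSet_Ioo]
      refine lintegral_congr fun t => ?_
      by_cases ht : 0 < t
      · have : ENNReal.ofReal t < u ↔ t < u := by
          rw [← ENNReal.ofReal_coe_nnreal, ENNReal.ofReal_lt_ofReal_iff_of_nonneg ht.le]
        by_cases htu : t < u <;> simp [Set.indicator_apply, ht, htu, this]
      · simp [Set.indicator_apply, ht]
    have h2 := htail 0
    rw [← Set.Ioc_union_Ioi_eq_Ioi (u.2 : (0 : ℝ) ≤ u), lintegral_union measurableSet_Ioi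
      (Set.Ioc_disjoint_Ioi le_rfl), htail, neg_zero, Real.exp_zero, ENNReal.ofReal_one] at h2
    rw [h1, setLIntegral_congr Ioo_ae_eq_Ioc, expNeg_coe]
    exact ENNReal.sub_eq_of_eq_add ENNReal.ofReal_ne_top h2.symm

/-! ### The power law gain -/

@[fun_prop]
theorem measurable_powerLawGain (b : ℝ) : Measurable (powerLawGain b) := by
  unfold powerLawGain
  fun_prop

/-- Solving for the distance gives a ball; `edist` accommodates an infinite radius when w = 0. -/
theorem lt_mul_powerLawGain_iff {b : ℝ} (hb : 0 < b) (p : ℝ≥0) (w : ℝ≥0∞)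
    (x y : Plane) :
    w < p * powerLawGain b (dist x y) ↔ edist x y < (p / w) ^ (1 / (2 * b)) := by
  have hd : ENNReal.ofReal (dist x y) ^ (2 * b) ≠ ∞ := by
    exact ENNReal.rpow_ne_top_of_nonneg (by positivity) ENNReal.ofReal_ne_top
  rcases eq_or_ne w ∞ with rfl | hw
  · rw [ENNReal.div_top, ENNReal.zero_rpow_of_pos (by positivity)]
    simp
  rw [powerLawGain, mul_one_div, ENNReal.lt_div_iff_mul_lt (Or.inr hw) (Or.inl hd),
    mul_comm, ← ENNReal.lt_div_iff_mul_lt (Or.inr hd) (Or.inl hw), one_div,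
    ENNReal.lt_rpow_inv_iff (by positivity), edist_dist]

theorem volume_lt_mul_powerLawGain {b : ℝ} (hb : 0 < b) (p : ℝ≥0) (w : ℝ≥0∞)
    (x : Plane) :
    volume {y : Plane | w < p * powerLawGain b (dist x y)} =
      ENNReal.ofReal Real.pi * (p / w) ^ (1 / b) := by
  simp_rw [lt_mul_powerLawGain_iff hb]
  have h : (p / w) ^ (1 / b) = ((p / w) ^ (1 / (2 * b))) ^ 2 := by
    rw [← ENNReal.rpow_natCast, ← ENNReal.rpow_mul]
    congr 1
    push_cast
    field_simp
  rw [h]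
  generalize (p / w) ^ (1 / (2 * b)) = ρ
  induction ρ using ENNReal.recTopCoe with
  | top =>
    have : {y : Plane | edist x y < ∞} = Set.univ := by ext; simp [edist_lt_top]
    rw [this]
    simp [Real.pi_pos]
  | coe ρ =>
    have : {y : Plane | edist x y < ρ} = Metric.ball x ρ := by
      ext y
      rw [Set.mem_ofPred_eq, Metric.mem_ball', edist_lt_coe, dist_nndist]
      norm_cast
    rw [this, EuclideanSpace.volume_ball_fin_two, ENNReal.ofReal_coe_nnreal, mul_comm]

theorem mul_powerLawGain_lt_iff {b : ℝ} (hb : 0 < b) {p : ℝ≥0} (hp : 0 < p) (x y z : Plane) :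
    p * powerLawGain b (dist x y) < p * powerLawGain b (dist x z) ↔ dist x z < dist x y := by
  have hp' : (p : ℝ≥0∞) ≠ 0 := by exact_mod_cast hp.ne'
  rw [lt_mul_powerLawGain_iff hb, powerLawGain, mul_one_div,
    ENNReal.div_div_cancel hp' ENNReal.coe_ne_top, one_div, ENNReal.rpow_rpow_inv (by positivity),
    edist_dist, ENNReal.ofReal_lt_ofReal_iff_of_nonneg dist_nonneg]

/-- The gain is strictly decreasing in the distance, so a level set lies on a sphere. -/
theorem volume_eq_mul_powerLawGain {b : ℝ} (hb : 0 < b) {p : ℝ≥0} (hp : 0 < p) (w : ℝ≥0∞)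
    (x : Plane) : volume {y : Plane | w = p * powerLawGain b (dist x y)} = 0 := by
  rcases Set.eq_empty_or_nonempty {y : Plane | w = p * powerLawGain b (dist x y)} with h | ⟨z, hz⟩
  · simp [h]
  · refine measure_mono_null (t := Metric.sphere x (dist z x)) (fun y hy => ?_)
      (Measure.addHaar_sphere _ _ _)
    have hyz : p * powerLawGain b (dist x y) = p * powerLawGain b (dist x z) :=
      (Eq.symm hy).trans hz
    rw [Metric.mem_sphere, dist_comm y, dist_comm z]
    refine le_antisymm (not_lt.1 fun h => ?_) (not_lt.1 fun h => ?_)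
    · exact ((mul_powerLawGain_lt_iff hb hp x y z).2 h).ne hyz
    · exact ((mul_powerLawGain_lt_iff hb hp x z y).2 h).ne hyz.symm

/-- By layers, the integral is that of the disc area π (p/t)^(1/b) against exp(-t) dt, a Gamma
integral that converges at 0 because b > 1. -/
theorem lintegral_one_sub_expNeg_powerLawGain {b : ℝ} (hb : 1 < b) (p : ℝ≥0)
    (x : Plane) :
    ∫⁻ y, 1 - expNeg (p * powerLawGain b (dist x y)) =
      ENNReal.ofReal (Real.pi * Real.Gamma (1 - 1 / b) * (p : ℝ) ^ (1 / b)) := by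
  have hb0 : 0 < b := by linarith
  simp_rw [one_sub_expNeg_eq_lintegral]
  have hm : Measurable fun z : Plane × ℝ =>
      {t : ℝ | ENNReal.ofReal t < p * powerLawGain b (dist x z.1)}.indicator
        (1 : ℝ → ℝ≥0∞) z.2 * ENNReal.ofReal (Real.exp (-z.2)) := by
    have : (fun z : Plane × ℝ => {t : ℝ | ENNReal.ofReal t <
        p * powerLawGain b (dist x z.1)}.indicator (1 : ℝ → ℝ≥0∞) z.2) =
        {z : Plane × ℝ | ENNReal.ofReal z.2 < p * powerLawGain b (dist x z.1)}.indicator 1 := rfl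
    refine Measurable.mul ?_ (by fun_prop)
    rw [this]
    exact measurable_one.indicator (measurableSet_lt (by fun_prop) (by fun_prop))
  rw [lintegral_lintegral_swap hm.aemeasurable]
  have h1 (t : ℝ) : ∫⁻ y : Plane, {t : ℝ | ENNReal.ofReal t < p * powerLawGain b (dist x y)}.indicator
        (1 : ℝ → ℝ≥0∞) t * ENNReal.ofReal (Real.exp (-t)) =
      ENNReal.ofReal Real.pi * (p / ENNReal.ofReal t) ^ (1 / b) *
        ENNReal.ofReal (Real.exp (-t)) := by
    have : (fun y : Plane => {t : ℝ | ENNReal.ofReal t <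
        p * powerLawGain b (dist x y)}.indicator (1 : ℝ → ℝ≥0∞) t) =
        {y : Plane | ENNReal.ofReal t < p * powerLawGain b (dist x y)}.indicator 1 := rfl
    have hms : MeasurableSet {y : Plane | ENNReal.ofReal t < p * powerLawGain b (dist x y)} :=
      measurableSet_lt (by fun_prop) (by fun_prop)
    rw [lintegral_mul_const _ (by rw [this]; exact measurable_one.indicator hms), this,
      lintegral_indicator_one hms, volume_lt_mul_powerLawGain hb0]
  simp_rw [h1]
  have hΓ : 0 < 1 - 1 / b := by rw [sub_pos, div_lt_one hb0]; exact hb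
  have hΓ' := Real.Gamma_pos_of_pos hΓ
  have h2 := lintegral_rpow_mul_expNeg hΓ 1
  rw [ENNReal.one_rpow, mul_one] at h2
  rw [mul_right_comm, ENNReal.ofReal_mul (by positivity), ← h2,
    ← lintegral_const_mul' _ _ ENNReal.ofReal_ne_top]
  refine setLIntegral_congr_fun measurableSet_Ioi fun t ht => ?_
  have ht' : (0 : ℝ) < t := ht
  rw [mul_one, expNeg_ofReal ht'.le, ← ENNReal.ofReal_coe_nnreal, ← ENNReal.ofReal_div_of_pos ht',
    ENNReal.ofReal_rpow_of_nonneg (by positivity) (by positivity),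
    ← ENNReal.ofReal_mul (by positivity), ← ENNReal.ofReal_mul (by positivity),
    ← ENNReal.ofReal_mul (by positivity), ← ENNReal.ofReal_mul (by positivity)]
  congr 1
  rw [Real.div_rpow (by positivity) ht'.le, show 1 - 1 / b - 1 = -(1 / b) by ring,
    Real.rpow_neg ht'.le]
  ring

end

noncomputable section

/-! ### The normalized sinc function -/

theorem normSinc_pos {x : ℝ} (h0 : 0 < x) (h1 : x < 1) : 0 < normSinc x := by
  have := Real.pi_pos
  refine div_pos (Real.sin_pos_of_pos_of_lt_pi (by positivity) ?_) (by positivity)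
  nlinarith

theorem normSinc_lt_one {x : ℝ} (h0 : 0 < x) : normSinc x < 1 := by
  have := Real.pi_pos
  rw [normSinc, div_lt_one (by positivity)]
  exact Real.sin_lt (by positivity)

theorem Gamma_mul_Gamma_one_sub_mul_normSinc {x : ℝ} (h0 : 0 < x) (h1 : x < 1) :
    Real.Gamma x * Real.Gamma (1 - x) * normSinc x = 1 / x := by
  have := Real.pi_pos
  have hs : 0 < Real.sin (Real.pi * x) :=
    Real.sin_pos_of_pos_of_lt_pi (by positivity) (by nlinarith)
  rw [Real.Gamma_mul_Gamma_one_sub, normSinc]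
  field_simp

/-! ### Edges and degrees -/

theorem binLog_strictMono : StrictMono binLog := by
  have h2 : 0 < Real.log 2 := Real.log_pos one_lt_two
  intro x y hxy
  exact EReal.strictMono_div_right_of_pos (by exact_mod_cast h2) (EReal.coe_ne_top _)
    (ENNReal.log_strictMono hxy)

/-- The positive part is irrelevant to strict positivity, and the logarithm is strictly increasing
on all of [0, ∞]. -/
theorem zero_lt_secrecyRate_iff {s t : ℝ≥0∞} : 0 < secrecyRate s t ↔ t < s := by
  rw [secrecyRate, lt_max_iff, or_iff_left (lt_irrefl _), EReal.sub_pos,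
    binLog_strictMono.lt_iff_lt, ENNReal.add_lt_add_iff_left ENNReal.one_ne_top]

theorem secureGraph_zero_adj_iff {g : ℝ → ℝ≥0∞} {p noise : ℝ≥0} (hnoise : 0 < noise)
    {V : Plane → ℝ≥0∞} {L : Set Plane} {x y : L} :
    (secureGraph g p noise noise 0 V L).Adj x y ↔
      (x : Plane) ≠ y ∧ V x < p * g (dist (x : Plane) y) := by
  have hn : (noise : ℝ≥0∞) ≠ 0 := by exact_mod_cast hnoise.ne'
  simp only [secureGraph, EReal.coe_zero, zero_lt_secrecyRate_iff, ne_eq, Subtype.ext_iff]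
  rw [ENNReal.div_lt_div_iff_left hn ENNReal.coe_ne_top]

/-- The triples of a transmitter, a receiver and eavesdroppers of power `W` that form an edge. -/
def edgeSet (g : ℝ → ℝ≥0∞) (p : ℝ≥0) (W : Plane × Config → ℝ≥0∞) :
    Set (Plane × Plane × Config) :=
  {z | z.1 ≠ z.2.1 ∧ W (z.1, z.2.2) < p * g (dist z.1 z.2.1)}

theorem measurableSet_edgeSet {g : ℝ → ℝ≥0∞} (hg : Measurable g) (p : ℝ≥0)
    {W : Plane × Config → ℝ≥0∞} (hW : Measurable W) : MeasurableSet (edgeSet g p W) := by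
  have h1 : MeasurableSet {z : Plane × Plane × Config | z.1 = z.2.1} :=
    measurableSet_eq_fun (by fun_prop) (by fun_prop)
  have h2 : MeasurableSet {z : Plane × Plane × Config | W (z.1, z.2.2) < p * g (dist z.1 z.2.1)} :=
    measurableSet_lt (by fun_prop) (by fun_prop)
  exact h1.compl.inter h2

theorem encard_setOf_subtype (L : Set Plane) (q : Plane → Prop) :
    {y : L | q y}.encard = (L ∩ {y | q y}).encard := by
  rw [← Subtype.val_injective.encard_image]
  congr 1
  ext y
  simp [and_comm]

theorem outDegree_secureGraph {g : ℝ → ℝ≥0∞} (hg : Measurable g) (p : ℝ≥0) {noise : ℝ≥0}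
    (hnoise : 0 < noise) {W : Plane × Config → ℝ≥0∞} (hW : Measurable W) (S E : Config)
    (x : S.1) :
    (outDegree (secureGraph g p noise noise 0 (fun x => W (x, E)) S.1) x : ℝ≥0∞) =
      ∫⁻ y, (edgeSet g p W).indicator 1 ((x : Plane), y, E) ∂(Config.counting S) := by
  have hm := (measurableSet_edgeSet hg p hW).preimage
    (f := fun y => ((x : Plane), y, E)) (by fun_prop)
  rw [outDegree]
  simp_rw [secureGraph_zero_adj_iff hnoise]
  rw [encard_setOf_subtype S.1 (fun y => (x : Plane) ≠ y ∧ W (x, E) < p * g (dist (x : Plane) y))]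
  exact (Config.counting_apply S hm).symm.trans (lintegral_indicator_one hm).symm

theorem inDegree_secureGraph {g : ℝ → ℝ≥0∞} (hg : Measurable g) (p : ℝ≥0) {noise : ℝ≥0}
    (hnoise : 0 < noise) {W : Plane × Config → ℝ≥0∞} (hW : Measurable W) (S E : Config)
    (x : S.1) :
    (inDegree (secureGraph g p noise noise 0 (fun x => W (x, E)) S.1) x : ℝ≥0∞) =
      ∫⁻ y, (edgeSet g p W).indicator 1 (y, (x : Plane), E) ∂(Config.counting S) := by
  have hm := (measurableSet_edgeSet hg p hW).preimage
    (f := fun y => (y, (x : Plane), E)) (by fun_prop)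
  rw [inDegree]
  simp_rw [secureGraph_zero_adj_iff hnoise]
  rw [encard_setOf_subtype S.1 (fun y => y ≠ (x : Plane) ∧ W (y, E) < p * g (dist y (x : Plane)))]
  exact (Config.counting_apply S hm).symm.trans (lintegral_indicator_one hm).symm

/-! ### Mean degrees in terms of the law of the eavesdroppers' power -/

namespace IsPoissonProcess

variable {Ω : Type*} [MeasurableSpace Ω] {X Y : Ω → Set Plane} {lamX lamY : ℝ≥0} {P : Measure Ω}

/-- Only the law of the power at the transmitter matters, so the transmitter may be moved to the
origin. This serves both kinds of degree. -/
theorem lintegral_edgeSet_left (hY : IsPoissonProcess Y lamY P) (g : ℝ → ℝ≥0∞)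
    (p : ℝ≥0) {W : Plane × Config → ℝ≥0∞} (hW : Measurable W)
    (hlaw : ∀ x, P.map (fun ω => W (x, hY.config ω)) = P.map fun ω => W (0, hY.config ω))
    {x y : Plane} (hxy : x ≠ y) :
    ∫⁻ ω, (edgeSet g p W).indicator 1 (x, y, hY.config ω) ∂P =
      P {ω | W (0, hY.config ω) < p * g (dist x y)} := by
  have hYm := hY.measurable_config
  have hm : MeasurableSet {ω | W (x, hY.config ω) < p * g (dist x y)} :=
    measurableSet_lt (by fun_prop) (by fun_prop)
  have h1 : (fun ω => (edgeSet g p W).indicator (1 : Plane × Plane × Config → ℝ≥0∞)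
        (x, y, hY.config ω)) =
      {ω | W (x, hY.config ω) < p * g (dist x y)}.indicator 1 := by
    ext ω
    simp [Set.indicator_apply, edgeSet, hxy]
  rw [h1, lintegral_indicator_one hm]
  have h2 := congrArg (fun μ => μ (Set.Iio (p * g (dist x y)))) (hlaw x)
  rwa [Measure.map_apply (by fun_prop) measurableSet_Iio,
    Measure.map_apply (by fun_prop) measurableSet_Iio] at h2

theorem lintegral_dist_eq (q : ℝ → ℝ≥0∞) (x : Plane) :
    ∫⁻ y : Plane, q (dist x y) = ∫⁻ y : Plane, q (dist 0 y) := by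
  rw [← lintegral_add_left_eq_self (fun y => q (dist x y)) x]
  simp

/-- If the law of the eavesdroppers' power does not depend on the transmitter, the average
degrees of a typical node are expressed by the law for the transmitter `0`. -/
theorem hasMeanDegree [IsProbabilityMeasure P] (hX : IsPoissonProcess X lamX P)
    (hY : IsPoissonProcess Y lamY P) (hXY : Indep (pointSigma X) (pointSigma Y) P)
    {g : ℝ → ℝ≥0∞} (hg : Measurable g) (p : ℝ≥0) {noise : ℝ≥0} (hnoise : 0 < noise)
    {V : Set Plane → Plane → ℝ≥0∞} (hV : Measurable fun z : Plane × Config => V z.2.1 z.1)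
    (hlaw : ∀ x, P.map (fun ω => V (Y ω) x) = P.map fun ω => V (Y ω) 0) :
    HasMeanInDegree P X Y lamX (fun L Ev => secureGraph g p noise noise 0 (V Ev) L)
        (lamX * ∫⁻ y : Plane, P {ω | V (Y ω) 0 < p * g (dist 0 y)}) ∧
      HasMeanOutDegree P X Y lamX (fun L Ev => secureGraph g p noise noise 0 (V Ev) L)
        (lamX * ∫⁻ y : Plane, P {ω | V (Y ω) 0 < p * g (dist 0 y)}) := by
  let W : Plane × Config → ℝ≥0∞ := fun z => V z.2.1 z.1
  have hE := measurableSet_edgeSet hg p hV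
  have hm : Measurable ((edgeSet g p W).indicator (1 : Plane × Plane × Config → ℝ≥0∞)) :=
    measurable_one.indicator hE
  have hne (x : Plane) : ∀ᵐ y : Plane, y ≠ x := by simp [ae_iff]
  constructor
  · refine hX.isTypicalMean hY hXY
      (H := fun z => (edgeSet g p W).indicator 1 (z.2.1, z.1, z.2.2)) (by fun_prop) ?_ ?_ ?_
    · intro x E
      simp [edgeSet]
    · exact fun S E x => inDegree_secureGraph hg p hnoise hV S E x
    · intro x
      rw [← lintegral_dist_eq (fun r => P {ω | V (Y ω) 0 < p * g r}) x]
      refine lintegral_congr_ae ?_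
      filter_upwards [hne x] with y hy
      -- For the in-degree the transmitter is the integration variable y; invariance of the law
      -- removes this dependence.
      rw [hY.lintegral_edgeSet_left g p hV hlaw hy, dist_comm]
      rfl
  · refine hX.isTypicalMean hY hXY (H := (edgeSet g p W).indicator 1) hm ?_ ?_ ?_
    · intro x E
      simp [edgeSet]
    · exact fun S E x => outDegree_secureGraph hg p hnoise hV S E x
    · intro x
      rw [← lintegral_dist_eq (fun r => P {ω | V (Y ω) 0 < p * g r}) x]
      refine lintegral_congr_ae ?_
      filter_upwards [hne x] with y hy
      rw [hY.lintegral_edgeSet_left g p hV hlaw hy.symm]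
      rfl

end IsPoissonProcess

/-! ### The power received by the eavesdroppers -/

theorem measurable_gain_dist {g : ℝ → ℝ≥0∞} (hg : Measurable g) (p : ℝ≥0) (x : Plane) :
    Measurable fun e : Plane => p * g (dist x e) := by fun_prop

theorem colludingPower_eq (g : ℝ → ℝ≥0∞) (p : ℝ≥0) (E : Config) (x : Plane) :
    colludingPower g p E.1 x = ∫⁻ e, p * g (dist x e) ∂(Config.counting E) := by
  rw [Config.lintegral_counting]
  rfl

theorem measurable_colludingPower {g : ℝ → ℝ≥0∞} (hg : Measurable g) (p : ℝ≥0) :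
    Measurable fun z : Plane × Config => colludingPower g p z.2.1 z.1 := by
  simp_rw [colludingPower_eq]
  exact Config.measurable_lintegral_counting measurable_snd
    (f := fun q : (Plane × Config) × Plane => p * g (dist q.1.1 q.2)) (by fun_prop)

/-- Turns the distribution function of the maximum into a void probability. -/
theorem strongestPower_le_iff {g : ℝ → ℝ≥0∞} (hg : Measurable g) (p : ℝ≥0) (E : Config)
    (x : Plane) (t : ℝ≥0∞) :
    strongestPower g p E.1 x ≤ t ↔ Config.counting E {e | t < p * g (dist x e)} = 0 := by
  have hm : MeasurableSet {e : Plane | t < p * g (dist x e)} :=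
    measurableSet_lt (by fun_prop) (by fun_prop)
  rw [Config.counting_apply E hm, ENat.toENNReal_eq_zero, Set.encard_eq_zero,
    Set.eq_empty_iff_forall_notMem, strongestPower, iSup_le_iff]
  simp

theorem measurable_strongestPower {g : ℝ → ℝ≥0∞} (hg : Measurable g) (p : ℝ≥0) :
    Measurable fun z : Plane × Config => strongestPower g p z.2.1 z.1 := by
  refine measurable_of_Iic fun t => ?_
  have h : (fun z : Plane × Config => strongestPower g p z.2.1 z.1) ⁻¹' Set.Iic t =
      {z | Config.counting z.2 {e | t < p * g (dist z.1 e)} = 0} := by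
    ext z
    exact strongestPower_le_iff hg p z.2 z.1 t
  have hm : MeasurableSet {q : (Plane × Config) × Plane | t < p * g (dist q.1.1 q.2)} :=
    measurableSet_lt (by fun_prop) (by fun_prop)
  rw [h]
  exact Kernel.measurable_kernel_prodMk_left (κ := Config.counting.comap _ measurable_snd) hm
    (measurableSet_singleton 0)

/-! ### Laws of the received power and the expected secure area -/

namespace IsPoissonProcess

variable {Ω : Type*} [MeasurableSpace Ω] {Y : Ω → Set Plane} {lam : ℝ≥0} {P : Measure Ω}

theorem map_colludingPower [IsProbabilityMeasure P] (hY : IsPoissonProcess Y lam P)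
    {g : ℝ → ℝ≥0∞} (hg : Measurable g) (p : ℝ≥0) (x : Plane) :
    P.map (fun ω => colludingPower g p (Y ω) x) = P.map fun ω => colludingPower g p (Y ω) 0 := by
  have h := hY.map_lintegral_comp (measurePreserving_add_left volume (-x))
    (measurable_gain_dist hg p 0)
  have h1 : ∀ x ω, colludingPower g p (Y ω) x =
      ∫⁻ e, p * g (dist x e) ∂(Config.counting (hY.config ω)) := fun x ω =>
    colludingPower_eq g p (hY.config ω) x
  simp_rw [h1, ← h]
  have h2 (e : Plane) : dist x e = dist 0 (-x + e) := by
    rw [dist_comm, dist_eq_norm, dist_zero_left, neg_add_eq_sub]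
  simp_rw [h2]

theorem measure_strongestPower_le [IsProbabilityMeasure P] (hY : IsPoissonProcess Y lam P)
    {g : ℝ → ℝ≥0∞} (hg : Measurable g) (p : ℝ≥0) (x : Plane) (t : ℝ≥0∞) :
    P {ω | strongestPower g p (Y ω) x ≤ t} =
      expNeg (lam * volume {e : Plane | t < p * g (dist x e)}) := by
  rw [← hY.measure_counting_eq_zero (measurableSet_lt (by fun_prop) (by fun_prop))]
  congr 1
  ext ω
  exact strongestPower_le_iff hg p (hY.config ω) x t

/-- The distribution function depends only on the area of a region that is translated along with x.
-/
theorem map_strongestPower [IsProbabilityMeasure P] (hY : IsPoissonProcess Y lam P)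
    {g : ℝ → ℝ≥0∞} (hg : Measurable g) (p : ℝ≥0) (x : Plane) :
    P.map (fun ω => strongestPower g p (Y ω) x) =
      P.map fun ω => strongestPower g p (Y ω) 0 := by
  have hm (x : Plane) : Measurable fun ω => strongestPower g p (Y ω) x :=
    (measurable_strongestPower hg p).comp (measurable_const.prodMk hY.measurable_config)
  have : IsProbabilityMeasure (P.map (fun ω => strongestPower g p (Y ω) x)) :=
    Measure.isProbabilityMeasure_map (hm x).aemeasurable
  refine Measure.ext_of_Iic _ _ fun t => ?_
  rw [Measure.map_apply (hm x) measurableSet_Iic, Measure.map_apply (hm 0) measurableSet_Iic]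
  have h (x : Plane) : P ((fun ω => strongestPower g p (Y ω) x) ⁻¹' Set.Iic t) = _ :=
    hY.measure_strongestPower_le hg p x t
  have hv (x : Plane) : volume {e : Plane | t < p * g (dist x e)} =
      ∫⁻ e, {r | t < p * g r}.indicator 1 (dist x e) :=
    (lintegral_indicator_one (μ := volume) (s := {e : Plane | t < p * g (dist x e)})
      (measurableSet_lt (by fun_prop) (by fun_prop))).symm
  rw [h, h, hv, hv, lintegral_dist_eq]

/-- The expected area of the region in which a receiver gets more power than `V`. -/
theorem lintegral_measure_lt [IsProbabilityMeasure P] {b : ℝ} {p : ℝ≥0} {V : Ω → ℝ≥0∞}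
    (hV : Measurable V) :
    ∫⁻ y : Plane, P {ω | V ω < p * powerLawGain b (dist 0 y)} =
      ∫⁻ ω, volume {y : Plane | V ω < p * powerLawGain b (dist 0 y)} ∂P := by
  have hm : MeasurableSet {z : Plane × Ω | V z.2 < p * powerLawGain b (dist 0 z.1)} :=
    measurableSet_lt (by fun_prop) (by fun_prop)
  exact (Measure.prod_apply hm).symm.trans (Measure.prod_apply_symm hm)

theorem lintegral_colluding [IsProbabilityMeasure P] (hY : IsPoissonProcess Y lam P)
    (hlam : 0 < lam) {p : ℝ≥0} (hp : 0 < p) {b : ℝ} (hb : 1 < b) :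
    ∫⁻ y : Plane, P {ω | colludingPower (powerLawGain b) p (Y ω) 0 <
        p * powerLawGain b (dist 0 y)} = ENNReal.ofReal (normSinc (1 / b) / lam) := by
  have hb0 : 0 < b := by linarith
  have ha0 : 0 < 1 / b := by positivity
  have ha1 : 1 / b < 1 := by rwa [div_lt_one hb0]
  have hg := measurable_powerLawGain b
  have hVm : Measurable fun ω => colludingPower (powerLawGain b) p (Y ω) 0 :=
    (measurable_colludingPower hg p).comp (measurable_const.prodMk hY.measurable_config)
  have hΓ1 := Real.Gamma_pos_of_pos ha0
  have hΓ2 := Real.Gamma_pos_of_pos (sub_pos.2 ha1)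
  have hpi := Real.pi_pos
  rw [lintegral_measure_lt hVm]
  have hpow (w : ℝ≥0∞) : (p / w) ^ (1 / b) = (p : ℝ≥0∞) ^ (1 / b) * w ^ (-(1 / b)) := by
    rw [ENNReal.div_rpow_of_nonneg _ _ ha0.le, ENNReal.rpow_neg, div_eq_mul_inv]
  simp_rw [volume_lt_mul_powerLawGain hb0, hpow]
  rw [lintegral_const_mul _ ((hVm.pow_const _).const_mul _),
    lintegral_const_mul _ (hVm.pow_const _)]
  -- The coefficient of s^(1/b) in the Laplace exponent of the received power.
  let K : ℝ := lam * (Real.pi * Real.Gamma (1 - 1 / b) * (p : ℝ) ^ (1 / b))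
  have hK : 0 < K := by positivity
  have hlaplace (s : ℝ) (hs : 0 < s) :
      ∫⁻ ω, expNeg (ENNReal.ofReal s * colludingPower (powerLawGain b) p (Y ω) 0) ∂P =
        expNeg (ENNReal.ofReal (K * s ^ (1 / b))) := by
    -- The Laplace variable s is absorbed into the transmit power.
    have h1 (ω : Ω) : ENNReal.ofReal s * colludingPower (powerLawGain b) p (Y ω) 0 =
        ∫⁻ e, (s.toNNReal * p : ℝ≥0) * powerLawGain b (dist 0 e)
          ∂(Config.counting (hY.config ω)) := by
      rw [show colludingPower (powerLawGain b) p (Y ω) 0 = _ from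
        colludingPower_eq _ p (hY.config ω) 0, ← lintegral_const_mul _ (by fun_prop)]
      simp_rw [ENNReal.coe_mul, mul_assoc]
      rfl
    simp_rw [h1]
    rw [hY.lintegral_expNeg (measurable_gain_dist hg _ 0),
      lintegral_one_sub_expNeg_powerLawGain hb, ← ENNReal.ofReal_coe_nnreal,
      ← ENNReal.ofReal_mul (by positivity)]
    congr 2
    rw [NNReal.coe_mul, Real.coe_toNNReal s hs.le, Real.mul_rpow hs.le (by positivity)]
    ring
  rw [lintegral_rpow_neg_of_laplace hVm ha0 hK hlaplace, ← ENNReal.ofReal_coe_nnreal,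
    ENNReal.ofReal_rpow_of_nonneg (by positivity) ha0.le,
    ← ENNReal.ofReal_mul (by positivity), ← ENNReal.ofReal_mul (by positivity)]
  congr 1
  have h := Gamma_mul_Gamma_one_sub_mul_normSinc ha0 ha1
  have hpp : 0 < (p : ℝ) ^ (1 / b) := by positivity
  have hlam' : (0 : ℝ) < lam := hlam
  rw [one_div_one_div] at h
  simp only [K]
  -- The reflection formula; the factors π and p^(1/b) cancel against those in K.
  rw [show normSinc (1 / b) = b / (Real.Gamma (1 / b) * Real.Gamma (1 - 1 / b)) by
    rw [eq_div_iff (by positivity)]; linarith]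
  field_simp

theorem lintegral_nonColluding [IsProbabilityMeasure P] (hY : IsPoissonProcess Y lam P)
    (hlam : 0 < lam) {p : ℝ≥0} (hp : 0 < p) {b : ℝ} (hb : 1 < b) :
    ∫⁻ y : Plane, P {ω | strongestPower (powerLawGain b) p (Y ω) 0 <
        p * powerLawGain b (dist 0 y)} = ENNReal.ofReal (1 / lam) := by
  have hb0 : 0 < b := by linarith
  have hg := measurable_powerLawGain b
  have hpi := Real.pi_pos
  have hlam' : (0 : ℝ) < lam := hlam
  have hVm : Measurable fun ω => strongestPower (powerLawGain b) p (Y ω) 0 :=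
    (measurable_strongestPower hg p).comp (measurable_const.prodMk hY.measurable_config)
  -- Passing to the non-strict inequality costs a null set and produces the void event of
  -- `measure_strongestPower_le`.
  have hle (w : ℝ≥0∞) : volume {y : Plane | w < p * powerLawGain b (dist 0 y)} =
      volume {y : Plane | w ≤ p * powerLawGain b (dist 0 y)} := by
    have : {y : Plane | w ≤ p * powerLawGain b (dist 0 y)} =
        {y : Plane | w < p * powerLawGain b (dist 0 y)} ∪
          {y : Plane | w = p * powerLawGain b (dist 0 y)} := by
      ext y
      exact le_iff_lt_or_eq (a := w)
    refine le_antisymm (measure_mono (this ▸ Set.subset_union_left)) ?_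
    rw [this]
    refine (measure_union_le _ _).trans ?_
    rw [volume_eq_mul_powerLawGain hb0 hp, add_zero]
  have hm : MeasurableSet {z : Plane × Ω | strongestPower (powerLawGain b) p (Y z.2) 0 ≤
      p * powerLawGain b (dist 0 z.1)} :=
    measurableSet_le (hVm.comp measurable_snd) (by fun_prop)
  rw [lintegral_measure_lt hVm]
  simp_rw [hle]
  refine ((Measure.prod_apply_symm hm).symm.trans (Measure.prod_apply hm)).trans ?_
  have h1 (y : Plane) : P (Prod.mk y ⁻¹' {z : Plane × Ω |
      strongestPower (powerLawGain b) p (Y z.2) 0 ≤ p * powerLawGain b (dist 0 z.1)}) =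
        ENNReal.ofReal (Real.exp (-(lam * Real.pi) * ‖y‖ ^ 2)) := by
    refine (hY.measure_strongestPower_le hg p 0 (p * powerLawGain b (dist 0 y))).trans ?_
    have hset : {e : Plane | p * powerLawGain b (dist 0 y) < p * powerLawGain b (dist 0 e)} =
        Metric.ball 0 ‖y‖ := by
      ext e
      rw [Set.mem_ofPred_eq, mul_powerLawGain_lt_iff hb0 hp, Metric.mem_ball', dist_zero_left y]
    rw [hset, EuclideanSpace.volume_ball_fin_two, ← ENNReal.ofReal_coe_nnreal,
      ← ENNReal.ofReal_pow (norm_nonneg _), ← ENNReal.ofReal_mul (by positivity),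
      ← ENNReal.ofReal_mul (by positivity), expNeg_ofReal (by positivity)]
    congr 2
    ring
  simp_rw [h1]
  refine lintegral_ofReal_eq_of_integral_eq (ae_of_all _ fun y => (Real.exp_pos _).le)
    (by positivity) ?_
  -- The planar Gaussian integral is π / (lam π).
  rw [GaussianFourier.integral_rexp_neg_mul_sq_norm (by positivity)]
  simp
  field_simp

end IsPoissonProcess

end

theorem mainTheorem12 {Ω : Type*} [MeasurableSpace Ω] (P : Measure Ω) [IsProbabilityMeasure P]
    (X Y : Ω → Set Plane) (lamL lamE : ℝ≥0) (hlamL : 0 < lamL) (hlamE : 0 < lamE)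
    (hX : IsPoissonProcess X lamL P) (hY : IsPoissonProcess Y lamE P)
    (hXY : Indep (pointSigma X) (pointSigma Y) P)
    (Ptx noiseL noiseE : ℝ≥0) (hPtx : 0 < Ptx) (hnoiseL : 0 < noiseL) (hnoise : noiseL = noiseE)
    (b : ℝ) (hb : 1 < b) :
    HasMeanInDegree P X Y lamL (colludingGraph (powerLawGain b) Ptx noiseL noiseE 0)
        (ENNReal.ofReal (lamL / lamE * normSinc (1 / b))) ∧
      HasMeanOutDegree P X Y lamL (colludingGraph (powerLawGain b) Ptx noiseL noiseE 0)
        (ENNReal.ofReal (lamL / lamE * normSinc (1 / b))) ∧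
      HasMeanInDegree P X Y lamL (nonColludingGraph (powerLawGain b) Ptx noiseL noiseE 0)
        (ENNReal.ofReal (lamL / lamE)) ∧
      HasMeanOutDegree P X Y lamL (nonColludingGraph (powerLawGain b) Ptx noiseL noiseE 0)
        (ENNReal.ofReal (lamL / lamE)) ∧
      0 < normSinc (1 / b) ∧ normSinc (1 / b) < 1 := by
  subst hnoise
  have ha0 : 0 < 1 / b := by positivity
  have ha1 : 1 / b < 1 := by rwa [div_lt_one (by linarith)]
  have hg := measurable_powerLawGain b
  have hcol := hX.hasMeanDegree hY hXY hg Ptx hnoiseL (measurable_colludingPower hg Ptx)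
    (hY.map_colludingPower hg Ptx)
  have hnon := hX.hasMeanDegree hY hXY hg Ptx hnoiseL (measurable_strongestPower hg Ptx)
    (hY.map_strongestPower hg Ptx)
  rw [hY.lintegral_colluding hlamE hPtx hb, ← ENNReal.ofReal_coe_nnreal,
    ← ENNReal.ofReal_mul lamL.coe_nonneg, ← mul_div_assoc, mul_div_right_comm] at hcol
  rw [hY.lintegral_nonColluding hlamE hPtx hb, ← ENNReal.ofReal_coe_nnreal,
    ← ENNReal.ofReal_mul lamL.coe_nonneg, mul_one_div] at hnon
  exact ⟨hcol.1, hcol.2, hnon.1, hnon.2, normSinc_pos ha0 ha1, normSinc_lt_one ha0⟩
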